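/- Let $m,n\ge 0$ and let $E_{ij}$, $1\le i,j\le m+n$, be the standard basis of the Lie superalgebra $\mathfrak{gl}_{m|n}$ over $\mathbb C$, with $\deg E_{ij}=\bar\imath+\bar\jmath$, where $\bar\imath=0$ for $i\le m$ and $\bar\imath=1$ for $i>m$, and $$E_{ij}E_{kl}-(-1)^{(\bar\imath+\bar\jmath)(\bar k+\bar l)}E_{kl}E_{ij}=\delta_{kj}E_{il}-\delta_{il}E_{kj}(-1)^{(\bar\imath+\bar\jmath)(\bar k+\bar l)}$$ in $\mathrm U(\mathfrak{gl}_{m|n})$. Let $\lambda=(\lambda_1,\dots,\lambda_m\,|\,\lambda_{m+1},\dots,\lambda_{m+n})$ be a tuple of nonnegative integers with $\lambda_1\ge\dots\ge\lambda_m$ and $\lambda_{m+1}\ge\dots\ge\lambda_{m+n}$, such that the number of nonzero components among $\lambda_{m+1},\dots,\lambda_{m+n}$ does not exceed $\lambda_m$ (no condition if $m=0$). Let $L(\lambda)$ be the irreducible representation of $\mathfrak{gl}_{m|n}$ with highest vector $\zeta\neq0$: $E_{ij}\zeta=0$ for $i<j$ and $E_{ii}\zeta=\lambda_i\zeta$ for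 all $i$. For $\mu=(\mu_1,\dots,\mu_m)$ put $$L(\lambda)^+_\mu=\{\eta\in L(\lambda)\mid E_{ij}\eta=0\ (1\le i<j\le m),\ E_{ii}\eta=\mu_i\eta\ (1\le i\le m)\}.$$ Put $h_i=E_{ii}-i+1$ for $1\le i\le m$. For $1\le i\le m<a\le m+n$ let $$z_{ai}=\sum_{i<i_1<\dots<i_s\le m}E_{i_1i}E_{i_2i_1}\cdots E_{i_si_{s-1}}E_{ai_s}\,(h_i-h_{j_1})\cdots(h_i-h_{j_r}),$$ where $s=0,1,\dots$ and $\{j_1,\dots,j_r\}$ is the complement of $\{i_1,\dots,i_s\}$ in $\{i+1,\dots,m\}$ (the term for $s=0$ is $E_{ai}(h_i-h_{i+1})\cdots(h_i-h_m)$). The Yangian $\mathrm Y(\mathfrak{gl}_n)$ is the unital associative algebra over $\mathbb C$ with generators $t_{ij}^{(r)}$, $1\le i,j\le n$, $r\ge1$, and relations $[t^{(r+1)}_{ij},t^{(s)}_{kl}]-[t^{(r)}_{ij},t^{(s+1)}_{kl}]=t^{(r)}_{kj}t^{(s)}_{il}-t^{(s)}_{kj}t^{(r)}_{il}$ for $r,s\ge0$,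 with $t^{(0)}_{ij}=\delta_{ij}$; put $t_{ij}(u)=\sum_{r\ge0}t_{ij}^{(r)}u^{-r}$. It acts on $L(\lambda)^+_\mu$ so that $t_{ij}(u)$ acts as the series $\psi_{ij}(u+m)$, expanded in powers of $u^{-1}$, where $$\psi_{ij}(u)=\delta_{ij}+E_{m+i,m+j}\,u^{-1}+\sum_{r\ge2}\ \sum_{k,l=1}^mE_{m+i,k}(E^{r-2})_{kl}E_{l,m+j}\,u^{-r}$$ and $E=(E_{kl})_{k,l=1}^m$ is the $m\times m$ matrix with entries in $\mathrm U(\mathfrak{gl}_m)$. Let $\mu=(\mu_1,\dots,\mu_m)$ be a partition ($\mu_1\ge\dots\ge\mu_m\ge0$ integers) with $0\le\lambda_i-\mu_i\le n$ for all $i=1,\dots,m$, and let $$\zeta_\mu=\prod_{j=1}^m\big(z_{m+\lambda_j-\mu_j,\,j}\cdots z_{m+2,\,j}\,z_{m+1,\,j}\big)\,\zeta,$$ the factors being taken from left to right in the increasing order of $j$. Then the above formulas give a well-defined action of $\mathrm Y(\mathfrak{gl}_n)$ on $L(\lambda)^+_\mu$, the vector $\zeta_\mu$ lies in $L(\lambda)^+_\mu$,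 and $$t_{ij}(u)\,\zeta_\mu=0\quad\text{for }1\le i<j\le n,\qquad t_{pp}(u)\,\zeta_\mu=\lambda_{m+p}(u)\,\zeta_\mu\quad\text{for }p=1,\dots,n,$$ where, expanded as a power series in $u^{-1}$, $$\lambda_{m+p}(u)=\frac{u+\lambda_{m+p}+m}{u+m}\prod_{\substack{1\le i\le m\\ \lambda_i-\mu_i\ge p}}\frac{u-\mu_i+i}{u-\mu_i+i-1}.$$ -/

import Mathlib

namespace CovariantYangian

/-! ### The Lie superalgebra `gl_{m|n}` and its enveloping algebra

The index set `{1,…,m+n}` is `Fin m ⊕ Fin n`; `Sum.inl` holds the even indices `1,…,m` and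
`Sum.inr` the odd indices `m+1,…,m+n`. -/

/-- The parity `ī` of an index. -/
def parity {m n : ℕ} : Fin m ⊕ Fin n → ℕ := Sum.elim (fun _ => 0) (fun _ => 1)

/-- The sign `(-1)^{(ī+j̄)(k̄+l̄)}`. -/
noncomputable def superSign {m n : ℕ} (i j k l : Fin m ⊕ Fin n) : ℂ :=
  (-1) ^ ((parity i + parity j) * (parity k + parity l))

/-- The relations of `U(gl_{m|n})`: the supercommutator `E_ij E_kl - (±) E_kl E_ij` equals
`δ_kj E_il - δ_il (±) E_kj`, with `± = (-1)^{(ī+j̄)(k̄+l̄)}`. -/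
inductive GLRel (m n : ℕ) :
    FreeAlgebra ℂ ((Fin m ⊕ Fin n) × (Fin m ⊕ Fin n)) →
    FreeAlgebra ℂ ((Fin m ⊕ Fin n) × (Fin m ⊕ Fin n)) → Prop
  | comm (i j k l : Fin m ⊕ Fin n) :
      GLRel m n
        (FreeAlgebra.ι ℂ (i, j) * FreeAlgebra.ι ℂ (k, l)
          - superSign i j k l • (FreeAlgebra.ι ℂ (k, l) * FreeAlgebra.ι ℂ (i, j)))
        ((if k = j then FreeAlgebra.ι ℂ (i, l) else 0)
          - (if i = l then superSign i j k l • FreeAlgebra.ι ℂ (k, j) else 0))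

/-- The universal enveloping algebra `U(gl_{m|n})` over `ℂ`. -/
abbrev UGL (m n : ℕ) : Type := RingQuot (GLRel m n)

/-- The generator `E_ij`. -/
noncomputable def E {m n : ℕ} (i j : Fin m ⊕ Fin n) : UGL m n :=
  RingQuot.mkAlgHom ℂ (GLRel m n) (FreeAlgebra.ι ℂ (i, j))

/-- `ζ` is a highest vector of weight `lam`: nonzero, `E_ij ζ = 0` for `i < j`
and `E_ii ζ = λ_i ζ`. -/
def IsHighestVector {m n : ℕ} {V : Type*} [AddCommGroup V] [Module ℂ V] [Module (UGL m n) V]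
    (lam : Fin m ⊕ Fin n → ℂ) (ζ : V) : Prop :=
  ζ ≠ 0 ∧
  (∀ i j : Fin m ⊕ Fin n, Sum.Lex (· < ·) (· < ·) i j → (E i j : UGL m n) • ζ = 0) ∧
  (∀ i : Fin m ⊕ Fin n, (E i i : UGL m n) • ζ = lam i • ζ)

/-- Covariant highest weights: nonnegative integers with `λ_1 ≥ … ≥ λ_m`,
`λ_{m+1} ≥ … ≥ λ_{m+n}`, and the number of nonzero components among `λ_{m+1}, …, λ_{m+n}`
at most `λ_m` (that is, at most each of `λ_1, …, λ_m`, as `λ_m` is the smallest of these). -/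
def IsCovariantWeight {m n : ℕ} (lam : Fin m ⊕ Fin n → ℕ) : Prop :=
  Antitone (fun i : Fin m => lam (Sum.inl i)) ∧
  Antitone (fun a : Fin n => lam (Sum.inr a)) ∧
  ∀ i : Fin m,
    (Finset.univ.filter (fun a : Fin n => lam (Sum.inr a) ≠ 0)).card ≤ lam (Sum.inl i)

/-- The space of `gl_m`-highest vectors of weight `mu` in a `gl_{m|n}`-module. -/
def multiplicitySpace {m : ℕ} (n : ℕ) (V : Type*) [AddCommGroup V] [Module ℂ V]
    [Module (UGL m n) V] [IsScalarTower ℂ (UGL m n) V] (mu : Fin m → ℂ) : Submodule ℂ V where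
  carrier := {η | (∀ i j : Fin m, i < j → (E (Sum.inl i) (Sum.inl j) : UGL m n) • η = 0) ∧
    ∀ i : Fin m, (E (Sum.inl i) (Sum.inl i) : UGL m n) • η = mu i • η}
  add_mem' := by
    rintro a b ⟨ha, ha'⟩ ⟨hb, hb'⟩
    refine ⟨fun i j hij => ?_, fun i => ?_⟩
    · rw [smul_add, ha i j hij, hb i j hij, add_zero]
    · rw [smul_add, ha' i, hb' i, smul_add]
  zero_mem' := ⟨fun i j _ => smul_zero _, fun i => by rw [smul_zero, smul_zero]⟩
  smul_mem' := by
    rintro c a ⟨ha, ha'⟩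
    refine ⟨fun i j hij => ?_, fun i => ?_⟩
    · rw [smul_algebra_smul_comm, ha i j hij, smul_zero]
    · rw [smul_algebra_smul_comm, ha' i, smul_comm]

/-! ### Lowering operators -/

/-- `h_i = E_ii - i + 1` for `1 ≤ i ≤ m`; here `i` is counted from `0`. -/
noncomputable def h {m : ℕ} (n : ℕ) (i : Fin m) : UGL m n :=
  E (Sum.inl i) (Sum.inl i) - algebraMap ℂ (UGL m n) ((i : ℕ) : ℂ)

/-- For a list `i₁, …, i_s`, the element `E_{i₁ i} E_{i₂ i₁} ⋯ E_{i_s i_{s-1}} E_{a i_s}`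
(which is `E_{a i}` for the empty list). -/
noncomputable def chain {m n : ℕ} (a : Fin n) : Fin m → List (Fin m) → UGL m n
  | i, [] => E (Sum.inr a) (Sum.inl i)
  | i, k :: ks => E (Sum.inl k) (Sum.inl i) * chain a k ks

/-- The lowering operator `z_{ai}`: the sum over `i < i₁ < ⋯ < i_s ≤ m` of
`E_{i₁ i} E_{i₂ i₁} ⋯ E_{i_s i_{s-1}} E_{a i_s} (h_i - h_{j₁}) ⋯ (h_i - h_{j_r})`,
with `{j₁, …, j_r}` the complement of `{i₁, …, i_s}` in `{i+1, …, m}`. -/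
noncomputable def zLower {m n : ℕ} (a : Fin n) (i : Fin m) : UGL m n :=
  ∑ S ∈ (Finset.Ioi i).powerset,
    chain a i (S.sort (· ≤ ·)) *
      (((Finset.Ioi i \ S).sort (· ≤ ·)).map (fun j => h n i - h n j)).prod

/-- The element `∏_{j=1}^m (z_{m+λ_j-μ_j,j} ⋯ z_{m+2,j} z_{m+1,j})`, with the factors in the
increasing order of `j` from left to right. The inner product runs over the indices
`m+1+a`, `0 ≤ a < λ_j - μ_j`, in decreasing order. -/
noncomputable def loweringProduct {m n : ℕ} (lam : Fin m ⊕ Fin n → ℕ) (mu : Fin m → ℕ) :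
    UGL m n :=
  (List.ofFn fun j : Fin m =>
    ((((List.finRange n).filter (fun a : Fin n => (a : ℕ) + mu j < lam (Sum.inl j))).reverse).map
      (fun a => zLower a j)).prod).prod

/-! ### The Yangian and its action -/

/-- The series coefficients `t_ij^{(r)}`, with `t_ij^{(0)} = δ_ij`, in the free algebra on
`t_ij^{(1)}, t_ij^{(2)}, …`; the free generator `(r, i, j)` is `t_ij^{(r+1)}`. -/
noncomputable def freeT (n : ℕ) : ℕ → Fin n → Fin n → FreeAlgebra ℂ (ℕ × Fin n × Fin n)
  | 0, i, j => if i = j then 1 else 0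
  | r + 1, i, j => FreeAlgebra.ι ℂ (r, i, j)

/-- The defining relations of the Yangian `Y(gl_n)`. -/
inductive YangianRel (n : ℕ) :
    FreeAlgebra ℂ (ℕ × Fin n × Fin n) → FreeAlgebra ℂ (ℕ × Fin n × Fin n) → Prop
  | rel (r s : ℕ) (i j k l : Fin n) :
      YangianRel n
        ((freeT n (r + 1) i j * freeT n s k l - freeT n s k l * freeT n (r + 1) i j)
          - (freeT n r i j * freeT n (s + 1) k l - freeT n (s + 1) k l * freeT n r i j))
        (freeT n r k j * freeT n s i l - freeT n s k j * freeT n r i l)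

/-- The Yangian `Y(gl_n)`. -/
abbrev Yangian (n : ℕ) : Type := RingQuot (YangianRel n)

/-- The element `t_ij^{(r)}` of the Yangian; `t_ij^{(0)} = δ_ij`. -/
noncomputable def t {n : ℕ} (r : ℕ) (i j : Fin n) : Yangian n :=
  RingQuot.mkAlgHom ℂ (YangianRel n) (freeT n r i j)

/-- The image `ψ(t_ij^{(r)})` under the (super) Olshanski homomorphism: `δ_ij` for `r = 0`,
`E_{m+i,m+j}` for `r = 1`, and `∑_{k,l} E_{m+i,k} (E^{r-2})_{kl} E_{l,m+j}` for `r ≥ 2`, where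
`E` is the `m × m` matrix with entries `E_kl`. -/
noncomputable def olshanski (m : ℕ) {n : ℕ} : ℕ → Fin n → Fin n → UGL m n
  | 0, i, j => if i = j then 1 else 0
  | 1, i, j => E (Sum.inr i) (Sum.inr j)
  | r + 2, i, j => ∑ k : Fin m, ∑ l : Fin m,
      E (Sum.inr i) (Sum.inl k) *
        ((Matrix.of fun p q : Fin m => (E (Sum.inl p) (Sum.inl q) : UGL m n)) ^ r) k l *
        E (Sum.inl l) (Sum.inr j)

/-- The coefficient of `u^{-s}` in `ψ(t_ij(u+m))`, the Olshanski homomorphism twisted by the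
automorphism `t_ij(u) ↦ t_ij(u+m)`. For `s ≥ 1`, the expansion
`(u+m)^{-r-1} = ∑_{s ≥ r} binom(s,r) (-m)^{s-r} u^{-s-1}` is used. -/
noncomputable def shiftedOlshanski (m : ℕ) {n : ℕ} : ℕ → Fin n → Fin n → UGL m n
  | 0, i, j => if i = j then 1 else 0
  | s + 1, i, j => ∑ r ∈ Finset.range (s + 1),
      ((s.choose r : ℂ) * (-(m : ℂ)) ^ (s - r)) • olshanski m (r + 1) i j

/-- The indeterminate `u`, in the field of formal Laurent series in `u^{-1}` over `ℂ`. -/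
noncomputable def u : LaurentSeries ℂ := HahnSeries.single (-1 : ℤ) (1 : ℂ)

/-- The expansion in powers of `u^{-1}` of
`λ_{m+p}(u) = (u+λ_{m+p}+m)/(u+m) ∏_{λ_i-μ_i ≥ p} (u-μ_i+i)/(u-μ_i+i-1)`. With `p` and `i`
counted from `0`, the condition becomes `p + 1 ≤ λ_i - μ_i` and `i` becomes `i + 1`. -/
noncomputable def highestWeight {m n : ℕ} (lam : Fin m ⊕ Fin n → ℕ) (mu : Fin m → ℕ)
    (p : Fin n) : LaurentSeries ℂ :=
  (u + (lam (Sum.inr p) : LaurentSeries ℂ) + (m : LaurentSeries ℂ)) /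
      (u + (m : LaurentSeries ℂ)) *
    ∏ i ∈ Finset.univ.filter (fun i : Fin m => (p : ℕ) + 1 + mu i ≤ lam (Sum.inl i)),
      (u - (mu i : LaurentSeries ℂ) + (((i : ℕ) : LaurentSeries ℂ) + 1)) /
        (u - (mu i : LaurentSeries ℂ) + (((i : ℕ) : LaurentSeries ℂ) + 1) - 1)

end CovariantYangian

namespace CovariantYangian

/-! Let E be the matrix of generators of `gl_m`, and for odd indices put R_i(u) = E_{i•}(u − E)⁻¹
and T_ij(u) = δ_ij + u⁻¹(E_ij + R_i(u)E_{•j}), the unshifted Olshanski series. As R_i(u)E_{•j}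
contracts a covector with a vector, T_ij(u) commutes with `gl_m` and preserves the spaces of
`gl_m`-highest vectors. The Yangian relations for T follow from [T_ij(u), E_ak] = R_{i,k}(u) T_aj(u)
(`olsh_comm_low`) and its mirror image (`high_comm_olsh`); they involve only the difference of the
spectral parameters, so they survive the shift by m (`yangianDefect_shift`).

On a `gl_m`-highest vector η of weight ν, z_ak is up to a scalar the contraction of E_{a•} with a
universal column depending only on η and k. After this lowering, right multiplication of a covector
by E becomes the scalar κ = m + ν_k − k − 1, with k counted from 0 (`lowered_shift_self`). Hence
T_ij(u) z_ak η = z_ak T_ij(u) η + (u − κ)⁻¹ z_ik T_aj(u) η (`defect_lowerLin`).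

Lowering operators with the same k anticommute (`lowered_anticomm`), by the characteristic identity
of E. Therefore a string Z = z_{a_1 k} ⋯ z_{a_d k} contributes a single pole: (u − κ + d −
1)(T_ij(u)Z − Z T_ij(u))η = ∑_p Z_p T_{a_p j}(u) η, where Z_p is Z with a_p replaced by i
(`defect_lowerString`). If the a_p are the first d odd indices, η is a Yangian highest vector and i
≤ j, the terms with a_p ≠ i vanish: either T_{a_p j}(u) kills η, or i is repeated in Z_p. So Zη is
again a Yangian highest vector, and the first d eigenvalues acquire the factor 1 + 1/(u − κ + d − 1)
(`IsYangianHighest.lowerString`).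

The strings act on ζ, whose eigenvalues are 1 + λ_{m+p}u⁻¹, from the largest k to the smallest. With
ν_k = λ_k and d = λ_k − μ_k the pole is at m + μ_k − k, and the shift of u by m gives the stated
product. No denominator vanishes because λ and μ are both weakly decreasing
(`stageWeight_isRegular`). -/

open Sum (inl inr)

/-! ### The relations of `gl_{m|n}` by parity blocks -/

section Relations

variable {m n : ℕ}

variable {A : Type*} [Ring A] [Algebra ℂ A]

/-- A system of elements of an algebra satisfying the defining relations of `U(gl_{m|n})`. -/
def IsGLSystem (e : Fin m ⊕ Fin n → Fin m ⊕ Fin n → A) : Prop :=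
  ∀ i j k l, e i j * e k l - superSign i j k l • (e k l * e i j) =
      (if k = j then e i l else 0) - (if i = l then superSign i j k l • e k j else 0)

variable {e : Fin m ⊕ Fin n → Fin m ⊕ Fin n → A}

theorem IsGLSystem.comm_even_even (he : IsGLSystem e) (p q r s : Fin m) :
    (e (inl p) (inl q) * e (inl r) (inl s)) =
      e (inl r) (inl s) * e (inl p) (inl q) +
        ((if q = r then e (inl p) (inl s) else 0) - if p = s then e (inl r) (inl q) else 0) := by
  have := he (inl p) (inl q) (inl r) (inl s)
  simp [superSign, parity, eq_comm (a := r)] at this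
  rw [← this]; abel

theorem IsGLSystem.comm_even_low (he : IsGLSystem e) (p q r : Fin m) (a : Fin n) :
    (e (inl p) (inl q) * e (inr a) (inl r)) =
      e (inr a) (inl r) * e (inl p) (inl q) - if p = r then e (inr a) (inl q) else 0 := by
  have := he (inl p) (inl q) (inr a) (inl r)
  simp [superSign, parity] at this
  rw [sub_eq_iff_eq_add.1 this]; abel

theorem IsGLSystem.comm_even_high (he : IsGLSystem e) (p q r : Fin m) (a : Fin n) :
    (e (inl p) (inl q) * e (inl r) (inr a)) =
      e (inl r) (inr a) * e (inl p) (inl q) + if q = r then e (inl p) (inr a) else 0 := by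
  have := he (inl p) (inl q) (inl r) (inr a)
  simp [superSign, parity, eq_comm (a := r)] at this
  rw [sub_eq_iff_eq_add.1 this]; abel

theorem IsGLSystem.comm_even_odd (he : IsGLSystem e) (p q : Fin m) (a b : Fin n) :
    (e (inl p) (inl q) * e (inr a) (inr b)) =
      e (inr a) (inr b) * e (inl p) (inl q) := by
  have := he (inl p) (inl q) (inr a) (inr b)
  simp [superSign, parity] at this
  rw [sub_eq_zero.1 this]

theorem IsGLSystem.comm_odd_odd (he : IsGLSystem e) (a b c d : Fin n) :
    (e (inr a) (inr b) * e (inr c) (inr d)) =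
      e (inr c) (inr d) * e (inr a) (inr b) +
        ((if b = c then e (inr a) (inr d) else 0) - if a = d then e (inr c) (inr b) else 0) := by
  have := he (inr a) (inr b) (inr c) (inr d)
  have h4 : (-1 : ℂ) ^ 4 = 1 := by norm_num
  simp [superSign, parity, eq_comm (a := c), h4] at this
  rw [← this]; abel

theorem IsGLSystem.comm_odd_low (he : IsGLSystem e) (a b c : Fin n) (p : Fin m) :
    (e (inr a) (inr b) * e (inr c) (inl p)) =
      e (inr c) (inl p) * e (inr a) (inr b) + if b = c then e (inr a) (inl p) else 0 := by
  have := he (inr a) (inr b) (inr c) (inl p)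
  simp [superSign, parity, eq_comm (a := c)] at this
  rw [sub_eq_iff_eq_add.1 this]; abel

theorem IsGLSystem.comm_odd_high (he : IsGLSystem e) (a b c : Fin n) (p : Fin m) :
    (e (inr a) (inr b) * e (inl p) (inr c)) =
      e (inl p) (inr c) * e (inr a) (inr b) - if a = c then e (inl p) (inr b) else 0 := by
  have := he (inr a) (inr b) (inl p) (inr c)
  simp [superSign, parity] at this
  rw [sub_eq_iff_eq_add.1 this]; abel

theorem IsGLSystem.anticomm_low_low (he : IsGLSystem e) (a b : Fin n) (p q : Fin m) :
    (e (inr a) (inl p) * e (inr b) (inl q)) =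
      -(e (inr b) (inl q) * e (inr a) (inl p)) := by
  have := he (inr a) (inl p) (inr b) (inl q)
  simp [superSign, parity] at this
  rw [eq_neg_iff_add_eq_zero, this]

theorem IsGLSystem.anticomm_high_high (he : IsGLSystem e) (a b : Fin n) (p q : Fin m) :
    (e (inl p) (inr a) * e (inl q) (inr b)) =
      -(e (inl q) (inr b) * e (inl p) (inr a)) := by
  have := he (inl p) (inr a) (inl q) (inr b)
  simp [superSign, parity] at this
  rw [eq_neg_iff_add_eq_zero, this]

theorem IsGLSystem.anticomm_high_low (he : IsGLSystem e) (a b : Fin n) (p q : Fin m) :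
    (e (inl p) (inr a) * e (inr b) (inl q)) =
      -(e (inr b) (inl q) * e (inl p) (inr a)) +
        ((if a = b then e (inl p) (inl q) else 0) + if p = q then e (inr b) (inr a) else 0) := by
  have := he (inl p) (inr a) (inr b) (inl q)
  simp [superSign, parity, eq_comm (a := b)] at this
  have h2 : (if p = q then -(e (inr b) (inr a)) else 0)
      = -(if p = q then e (inr b) (inr a) else 0) := by split_ifs <;> simp
  rw [h2, sub_neg_eq_add] at this
  rw [← this]; abel

end Relations

/-! ### The super Olshanski homomorphism and the Yangian relations -/

section Resolvent

variable {m n : ℕ} {A : Type*} [Ring A] (e : Fin m ⊕ Fin n → Fin m ⊕ Fin n → A)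

/-- The matrix of the generators of `gl_m`. -/
noncomputable def evenMatrix : Matrix (Fin m) (Fin m) A :=
  Matrix.of fun p q : Fin m => (e (inl p) (inl q))

/-- The coefficients of the row vectors `E_{m+i,•} (u - E)⁻¹`. -/
noncomputable def rowRes (r : ℕ) (i : Fin n) (p : Fin m) : A :=
  ∑ k, e (inr i) (inl k) * (evenMatrix e ^ r) k p

/-- The coefficients of the column vectors `(u - E)⁻¹ E_{•,m+j}`. -/
noncomputable def colRes (r : ℕ) (p : Fin m) (j : Fin n) : A :=
  ∑ l, (evenMatrix e ^ r) p l * e (inl l) (inr j)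

/-- The images of the generators of the Yangian under the Olshanski homomorphism. -/
noncomputable def olsh : ℕ → Fin n → Fin n → A
  | 0, i, j => if i = j then 1 else 0
  | 1, i, j => e (inr i) (inr j)
  | r + 2, i, j => ∑ p, rowRes e r i p * e (inl p) (inr j)

variable {e}

@[simp] theorem rowRes_zero (i : Fin n) (p : Fin m) : rowRes e 0 i p = e (inr i) (inl p) := by
  simp [rowRes, Matrix.one_apply]

@[simp] theorem colRes_zero (p : Fin m) (j : Fin n) : colRes e 0 p j = e (inl p) (inr j) := by
  simp [colRes, Matrix.one_apply]

theorem rowRes_succ (r : ℕ) (i : Fin n) (p : Fin m) :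
    rowRes e (r + 1) i p = ∑ q, rowRes e r i q * e (inl q) (inl p) := by
  simp only [rowRes, pow_succ, Matrix.mul_apply, Finset.mul_sum, Finset.sum_mul, ← mul_assoc]
  rw [Finset.sum_comm]; rfl

theorem colRes_succ (r : ℕ) (p : Fin m) (j : Fin n) :
    colRes e (r + 1) p j = ∑ q, e (inl p) (inl q) * colRes e r q j := by
  simp only [colRes, pow_succ', Matrix.mul_apply, Finset.mul_sum, Finset.sum_mul, mul_assoc]
  rw [Finset.sum_comm]; rfl

@[simp] theorem olsh_zero (i j : Fin n) :
    olsh e 0 i j = if i = j then 1 else 0 := rfl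

@[simp] theorem olsh_one (i j : Fin n) :
    olsh e 1 i j = e (inr i) (inr j) := rfl

theorem olsh_eq_row (r : ℕ) (i j : Fin n) :
    olsh e (r + 2) i j = ∑ p, rowRes e r i p * e (inl p) (inr j) := rfl

theorem olsh_eq_col (r : ℕ) (i j : Fin n) :
    olsh e (r + 2) i j = ∑ p, e (inr i) (inl p) * colRes e r p j := by
  simp only [olsh, rowRes, colRes, Finset.mul_sum, Finset.sum_mul, mul_assoc]
  rw [Finset.sum_comm]

/-- Each entry of E commutes with x, so powers of E can be carried one at a time from the column,
across x, to the row. -/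
theorem sum_rowRes_mul_colRes (x : A)
    (hx : ∀ p q : Fin m, e (inl p) (inl q) * x = x * e (inl p) (inl q))
    (s a : ℕ) (k l : Fin n) :
    ∑ p, rowRes e s k p * x * colRes e a p l =
      ∑ p, rowRes e (a + s) k p * x * e (inl p) (inr l) := by
  induction a generalizing s with
  | zero => simp
  | succ a ih =>
    rw [show a + 1 + s = a + (s + 1) by omega, ← ih]
    simp only [rowRes_succ, colRes_succ, Finset.mul_sum, Finset.sum_mul]
    rw [Finset.sum_comm]
    refine Finset.sum_congr rfl fun q _ => Finset.sum_congr rfl fun p _ => ?_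
    rw [mul_assoc (rowRes e s k p) (e _ _) x, hx]
    simp only [mul_assoc]

variable [Algebra ℂ A]

/-! ### Commutation with `gl_m` and `gl_n` -/

theorem IsGLSystem.even_mul_rowRes (he : IsGLSystem e) (p q : Fin m) (r : ℕ) (i : Fin n) (k : Fin m) :
    e (inl p) (inl q) * rowRes e r i k =
      rowRes e r i k * e (inl p) (inl q) - if p = k then rowRes e r i q else 0 := by
  induction r generalizing k with
  | zero => simp [he.comm_even_low]
  | succ r ih =>
    simp only [rowRes_succ, Finset.mul_sum, Finset.sum_mul, ← mul_assoc, ih, sub_mul]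
    simp only [mul_assoc, he.comm_even_even p q, mul_add, mul_sub, Finset.sum_add_distrib,
      Finset.sum_sub_distrib, mul_ite, ite_mul, mul_zero, zero_mul, Finset.sum_ite_eq,
      Finset.mem_univ, if_true]
    by_cases h : p = k
    · simp [h]; abel
    · simp [h]

/-- A contraction of a covector with a vector is invariant: the two delta terms cancel. This is why
the Yangian acts on multiplicity spaces. -/
theorem IsGLSystem.even_mul_olsh (he : IsGLSystem e) (p q : Fin m) (r : ℕ) (i j : Fin n) :
    e (inl p) (inl q) * olsh e r i j = olsh e r i j * e (inl p) (inl q) := by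
  match r with
  | 0 => simp
  | 1 => simp [he.comm_even_odd]
  | r + 2 =>
    simp only [olsh_eq_row, Finset.mul_sum, Finset.sum_mul]
    simp only [← mul_assoc, he.even_mul_rowRes, sub_mul]
    simp only [mul_assoc, he.comm_even_high, mul_add, Finset.sum_add_distrib, Finset.sum_sub_distrib,
      mul_ite, ite_mul, mul_zero, zero_mul, Finset.sum_ite_eq, Finset.mem_univ, if_true]
    abel

theorem IsGLSystem.odd_mul_rowRes (he : IsGLSystem e) (a b : Fin n) (r : ℕ) (i : Fin n) (k : Fin m) :
    e (inr a) (inr b) * rowRes e r i k =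
      rowRes e r i k * e (inr a) (inr b) + if b = i then rowRes e r a k else 0 := by
  induction r generalizing k with
  | zero => simp [he.comm_odd_low]
  | succ r ih =>
    simp only [rowRes_succ, Finset.mul_sum, Finset.sum_mul, ← mul_assoc, ih, add_mul]
    simp only [mul_assoc, ← he.comm_even_odd, Finset.sum_add_distrib]
    by_cases h : b = i <;> simp [h]

/-- The array T_ij transforms under `gl_n` like E_ij. This supplies the Yangian relations in degrees
0 and 1, where the resolvent form is not available. -/
theorem IsGLSystem.odd_mul_olsh (he : IsGLSystem e) (a b : Fin n) (r : ℕ) (i j : Fin n) :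
    e (inr a) (inr b) * olsh e r i j = olsh e r i j * e (inr a) (inr b) +
      ((if b = i then olsh e r a j else 0) - if a = j then olsh e r i b else 0) := by
  match r with
  | 0 =>
    have h : e (inr a) (inr b) * olsh e 0 i j = olsh e 0 i j * e (inr a) (inr b) := by
      rw [olsh_zero]; split_ifs <;> simp
    rw [h, left_eq_add]
    by_cases h1 : b = i
    · subst h1; simp
    · simp [h1, Ne.symm h1]
  | 1 => rw [olsh_one, he.comm_odd_odd]; rfl
  | r + 2 =>
    simp only [olsh_eq_row, Finset.mul_sum, Finset.sum_mul]
    simp only [← mul_assoc, he.odd_mul_rowRes, add_mul]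
    simp only [mul_assoc, he.comm_odd_high, mul_sub, Finset.sum_add_distrib, Finset.sum_sub_distrib]
    by_cases h : b = i <;> by_cases h' : a = j <;> simp [h, h'] <;> abel

/-! ### Commutation with the odd generators -/

/-- In generating series: R_{i,l}(u)E_ak + E_ak R_{i,l}(u) = −R_{i,k}(u)R_{a,l}(u). The finite sums
here and below are coefficients of such products. -/
theorem IsGLSystem.rowRes_anticomm_low (he : IsGLSystem e) (r : ℕ) (i a : Fin n) (l k : Fin m) :
    rowRes e r i l * e (inr a) (inl k) = -(e (inr a) (inl k) * rowRes e r i l) -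
      ∑ s ∈ Finset.range r, rowRes e s i k * rowRes e (r - 1 - s) a l := by
  induction r generalizing l with
  | zero => simp [he.anticomm_low_low i a]
  | succ r ih =>
    have hsum : ∑ s ∈ Finset.range (r + 1), rowRes e s i k * rowRes e (r + 1 - 1 - s) a l =
        (∑ q, ∑ s ∈ Finset.range r,
          rowRes e s i k * rowRes e (r - 1 - s) a q * e (inl q) (inl l))
          + rowRes e r i k * e (inr a) (inl l) := by
      rw [Finset.sum_range_succ, Finset.sum_comm]
      congr 1
      · refine Finset.sum_congr rfl fun s hs => ?_
        have := Finset.mem_range.1 hs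
        rw [show r + 1 - 1 - s = (r - 1 - s) + 1 by omega, rowRes_succ, Finset.mul_sum]
        simp only [mul_assoc]
      · simp
    rw [hsum]
    simp only [rowRes_succ, Finset.mul_sum, Finset.sum_mul]
    have h : ∀ q, rowRes e r i q * e (inl q) (inl l) * e (inr a) (inl k) =
        -(e (inr a) (inl k) * (rowRes e r i q * e (inl q) (inl l))) -
        (∑ s ∈ Finset.range r,
          rowRes e s i k * rowRes e (r - 1 - s) a q * e (inl q) (inl l)) -
          (if q = k then rowRes e r i q * e (inr a) (inl l) else 0) := by
      intro q
      rw [mul_assoc, he.comm_even_low, mul_sub, ← mul_assoc, ih, sub_mul, Finset.sum_mul]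
      simp only [mul_ite, mul_zero, neg_mul, mul_assoc]
    simp only [h, Finset.sum_sub_distrib, Finset.sum_neg_distrib, Finset.sum_ite_eq',
      Finset.mem_univ, if_true]
    abel

/-- In generating series: [T_ij(u), E_ak] = R_{i,k}(u) T_aj(u). The last two terms of the sum, with
T of degree 1 and 0, come from the `gl_n` part and from the delta in the anticommutator of two odd
generators. -/
theorem IsGLSystem.olsh_comm_low (he : IsGLSystem e) (r : ℕ) (i j a : Fin n) (k : Fin m) :
    olsh e r i j * e (inr a) (inl k) = e (inr a) (inl k) * olsh e r i j +
      ∑ s ∈ Finset.range r, rowRes e s i k * olsh e (r - 1 - s) a j := by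
  match r with
  | 0 => simp
  | 1 => simp [he.comm_odd_low, eq_comm (a := j)]
  | r + 2 =>
    have hsum : ∑ s ∈ Finset.range (r + 2), rowRes e s i k * olsh e (r + 2 - 1 - s) a j =
        (∑ q, ∑ s ∈ Finset.range r,
          rowRes e s i k * rowRes e (r - 1 - s) a q * e (inl q) (inr j))
          + rowRes e r i k * e (inr a) (inr j)
          + if a = j then rowRes e (r + 1) i k else 0 := by
      rw [Finset.sum_range_succ, Finset.sum_range_succ, Finset.sum_comm]
      congr 1
      · congr 1
        · refine Finset.sum_congr rfl fun s hs => ?_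
          have := Finset.mem_range.1 hs
          rw [show r + 2 - 1 - s = (r - 1 - s) + 2 by omega, olsh_eq_row, Finset.mul_sum]
          simp only [mul_assoc]
        · simp
      · simp
    rw [hsum]
    simp only [olsh_eq_row, Finset.mul_sum, Finset.sum_mul]
    have h : ∀ q, rowRes e r i q * e (inl q) (inr j) * e (inr a) (inl k) =
        e (inr a) (inl k) * (rowRes e r i q * e (inl q) (inr j)) +
        (∑ s ∈ Finset.range r,
          rowRes e s i k * rowRes e (r - 1 - s) a q * e (inl q) (inr j)) +
          (if a = j then rowRes e r i q * e (inl q) (inl k) else 0) +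
          (if q = k then rowRes e r i q * e (inr a) (inr j) else 0) := by
      intro q
      rw [mul_assoc, he.anticomm_high_low, mul_add, mul_neg, ← mul_assoc, he.rowRes_anticomm_low,
        sub_mul, Finset.sum_mul]
      simp only [mul_ite, mul_zero, neg_mul, mul_assoc, mul_add, eq_comm (a := j)]
      abel
    simp only [h, Finset.sum_add_distrib, Finset.sum_ite_eq',
      Finset.mem_univ, if_true]
    by_cases h' : a = j <;> simp [h', rowRes_succ] <;> abel

/-- The mirror image of `rowRes_anticomm_low`, with columns (u − E)⁻¹E_{•i} in place of rows. -/
theorem IsGLSystem.high_anticomm_colRes (he : IsGLSystem e) (r : ℕ) (i a : Fin n) (l k : Fin m) :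
    e (inl k) (inr a) * colRes e r l i = -(colRes e r l i * e (inl k) (inr a)) -
      ∑ s ∈ Finset.range r, colRes e (r - 1 - s) l a * colRes e s k i := by
  induction r generalizing l with
  | zero => simp [he.anticomm_high_high a i]
  | succ r ih =>
    have hsum : ∑ s ∈ Finset.range (r + 1), colRes e (r + 1 - 1 - s) l a * colRes e s k i =
        (∑ q, ∑ s ∈ Finset.range r,
          e (inl l) (inl q) * (colRes e (r - 1 - s) q a * colRes e s k i))
          + e (inl l) (inr a) * colRes e r k i := by
      rw [Finset.sum_range_succ, Finset.sum_comm]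
      congr 1
      · refine Finset.sum_congr rfl fun s hs => ?_
        have := Finset.mem_range.1 hs
        rw [show r + 1 - 1 - s = (r - 1 - s) + 1 by omega, colRes_succ, Finset.sum_mul]
        simp only [mul_assoc]
      · simp
    rw [hsum]
    simp only [colRes_succ, Finset.mul_sum, Finset.sum_mul]
    have h : ∀ q, e (inl k) (inr a) * (e (inl l) (inl q) * colRes e r q i) =
        -(e (inl l) (inl q) * colRes e r q i * e (inl k) (inr a)) -
        (∑ s ∈ Finset.range r,
          e (inl l) (inl q) * (colRes e (r - 1 - s) q a * colRes e s k i)) -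
          (if q = k then e (inl l) (inr a) * colRes e r q i else 0) := by
      intro q
      have h0 : e (inl k) (inr a) * e (inl l) (inl q) =
          e (inl l) (inl q) * e (inl k) (inr a) - if q = k then e (inl l) (inr a) else 0 := by
        rw [he.comm_even_high]; simp
      rw [← mul_assoc, h0, sub_mul, mul_assoc, ih, mul_sub, Finset.mul_sum]
      simp only [ite_mul, zero_mul, mul_neg, mul_assoc]
    simp only [h, Finset.sum_sub_distrib, Finset.sum_neg_distrib, Finset.sum_ite_eq',
      Finset.mem_univ, if_true]
    abel

theorem IsGLSystem.high_comm_olsh (he : IsGLSystem e) (r : ℕ) (i j a : Fin n) (k : Fin m) :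
    e (inl k) (inr a) * olsh e r j i = olsh e r j i * e (inl k) (inr a) +
      ∑ s ∈ Finset.range r, olsh e (r - 1 - s) j a * colRes e s k i := by
  match r with
  | 0 => simp
  | 1 =>
    simp only [olsh_one, he.comm_odd_high j i a k]
    simp
  | r + 2 =>
    have hsum : ∑ s ∈ Finset.range (r + 2), olsh e (r + 2 - 1 - s) j a * colRes e s k i =
        (∑ q, ∑ s ∈ Finset.range r,
          e (inr j) (inl q) * (colRes e (r - 1 - s) q a * colRes e s k i))
          + e (inr j) (inr a) * colRes e r k i
          + if a = j then colRes e (r + 1) k i else 0 := by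
      rw [Finset.sum_range_succ, Finset.sum_range_succ, Finset.sum_comm]
      congr 1
      · congr 1
        · refine Finset.sum_congr rfl fun s hs => ?_
          have := Finset.mem_range.1 hs
          rw [show r + 2 - 1 - s = (r - 1 - s) + 2 by omega, olsh_eq_col, Finset.sum_mul]
          simp only [mul_assoc]
        · simp
      · simp [eq_comm (a := j)]
    rw [hsum]
    simp only [olsh_eq_col, Finset.mul_sum, Finset.sum_mul]
    have h : ∀ q, e (inl k) (inr a) * (e (inr j) (inl q) * colRes e r q i) =
        e (inr j) (inl q) * colRes e r q i * e (inl k) (inr a) +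
        (∑ s ∈ Finset.range r,
          e (inr j) (inl q) * (colRes e (r - 1 - s) q a * colRes e s k i)) +
          (if a = j then e (inl k) (inl q) * colRes e r q i else 0) +
          (if k = q then e (inr j) (inr a) * colRes e r q i else 0) := by
      intro q
      rw [← mul_assoc, he.anticomm_high_low, add_mul, neg_mul, mul_assoc,
        he.high_anticomm_colRes, mul_sub, Finset.mul_sum]
      simp only [ite_mul, zero_mul, mul_neg, mul_assoc, add_mul]
      abel
    simp only [h, Finset.sum_add_distrib, Finset.sum_ite_eq,
      Finset.mem_univ, if_true]
    by_cases h' : a = j <;> simp [h', colRes_succ] <;> abel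

/-! ### The Yangian relations -/

/-- This is `olsh_comm_low` multiplied on the right by E^s, which T commutes with entrywise. -/
theorem IsGLSystem.olsh_comm_rowRes (he : IsGLSystem e) (r s : ℕ) (i j k : Fin n) (p : Fin m) :
    olsh e r i j * rowRes e s k p = rowRes e s k p * olsh e r i j +
      ∑ a ∈ Finset.range r, rowRes e (a + s) i p * olsh e (r - 1 - a) k j := by
  induction s generalizing p with
  | zero => simp [he.olsh_comm_low]
  | succ s ih =>
    simp only [rowRes_succ, ← add_assoc, Finset.mul_sum, Finset.sum_mul]
    rw [Finset.sum_comm, ← Finset.sum_add_distrib]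
    refine Finset.sum_congr rfl fun q _ => ?_
    rw [← mul_assoc, ih, add_mul, mul_assoc, ← he.even_mul_olsh, Finset.sum_mul, mul_assoc]
    congr 1
    refine Finset.sum_congr rfl fun a _ => ?_
    rw [mul_assoc, ← he.even_mul_olsh, mul_assoc]

theorem IsGLSystem.comm_olsh_olsh (he : IsGLSystem e) (r s : ℕ) (i j k l : Fin n) :
    olsh e r i j * olsh e (s + 2) k l - olsh e (s + 2) k l * olsh e r i j =
      (∑ a ∈ Finset.range r, ∑ p, rowRes e (a + s) i p * olsh e (r - 1 - a) k j *
          e (inl p) (inr l)) -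
        ∑ a ∈ Finset.range r, ∑ p, rowRes e (a + s) k p * olsh e (r - 1 - a) i l *
          e (inl p) (inr j) := by
  have h : ∀ p, olsh e r i j * (rowRes e s k p * e (inl p) (inr l)) =
      rowRes e s k p * e (inl p) (inr l) * olsh e r i j +
      (∑ a ∈ Finset.range r, rowRes e (a + s) i p * olsh e (r - 1 - a) k j *
          e (inl p) (inr l)) -
      ∑ a ∈ Finset.range r, rowRes e s k p * olsh e (r - 1 - a) i l * colRes e a p j := by
    intro p
    have := he.high_comm_olsh r j i l p
    rw [← mul_assoc, he.olsh_comm_rowRes, add_mul, mul_assoc _ (olsh e r i j),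
      ← sub_eq_iff_eq_add.2 this, mul_sub, Finset.sum_mul, Finset.mul_sum]
    simp only [mul_assoc]
    abel
  rw [olsh_eq_row, Finset.mul_sum, Finset.sum_mul]
  simp only [h, Finset.sum_add_distrib, Finset.sum_sub_distrib]
  rw [Finset.sum_comm, add_sub_assoc, add_sub_cancel_left,
    Finset.sum_comm (f := fun p a => rowRes e s k p * olsh e (r - 1 - a) i l * colRes e a p j)]
  congr 1
  refine Finset.sum_congr rfl fun a _ => ?_
  rw [sum_rowRes_mul_colRes _ fun p q => he.even_mul_olsh p q _ _ _]

/-- The difference of the two sides of the defining relations of the Yangian. -/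
def yangianDefect (t : ℕ → Fin n → Fin n → A) (r s : ℕ) (i j k l : Fin n) : A :=
  ((t (r + 1) i j * t s k l - t s k l * t (r + 1) i j)
    - (t r i j * t (s + 1) k l - t (s + 1) k l * t r i j))
    - (t r k j * t s i l - t s k j * t r i l)

/-- In the difference of the two commutators the sums of `comm_olsh_olsh` telescope to their terms
with a = 0. The right-hand side leaves the same terms: reordering its two products produces a common
sum, which cancels. -/
theorem IsGLSystem.yangian_of_two_le (he : IsGLSystem e) (r s : ℕ) (i j k l : Fin n) :
    yangianDefect (olsh e) r (s + 2) i j k l = 0 := by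
  have h1 : olsh e r k j * olsh e (s + 2) i l =
      (∑ p, rowRes e s i p * olsh e r k j * e (inl p) (inr l)) +
      ∑ a ∈ Finset.range r, ∑ p, rowRes e (a + s) k p * olsh e (r - 1 - a) i j *
          e (inl p) (inr l) := by
    rw [olsh_eq_row, Finset.mul_sum, Finset.sum_comm, ← Finset.sum_add_distrib]
    refine Finset.sum_congr rfl fun p _ => ?_
    rw [← mul_assoc, he.olsh_comm_rowRes, add_mul, Finset.sum_mul]
  have h2 : olsh e (s + 2) k j * olsh e r i l =
      (∑ p, rowRes e s k p * olsh e r i l * e (inl p) (inr j)) +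
      ∑ a ∈ Finset.range r, ∑ p, rowRes e (a + s) k p * olsh e (r - 1 - a) i j *
          e (inl p) (inr l) := by
    have h3 : ∀ a, ∑ p, rowRes e (a + s) k p * olsh e (r - 1 - a) i j * e (inl p) (inr l) =
        ∑ p, rowRes e s k p * olsh e (r - 1 - a) i j * colRes e a p l := fun a =>
      (sum_rowRes_mul_colRes _ (fun p q => he.even_mul_olsh p q _ _ _) _ _ _ _).symm
    simp only [h3]
    rw [olsh_eq_row, Finset.sum_mul, Finset.sum_comm, ← Finset.sum_add_distrib]
    refine Finset.sum_congr rfl fun p _ => ?_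
    rw [mul_assoc, he.high_comm_olsh, mul_add, Finset.mul_sum]
    simp only [mul_assoc]
  have h4 : ∀ i j k l : Fin n, ∑ a ∈ Finset.range (r + 1), ∑ p, rowRes e (a + s) i p *
        olsh e (r + 1 - 1 - a) k j * e (inl p) (inr l) =
      (∑ a ∈ Finset.range r, ∑ p, rowRes e (a + (s + 1)) i p * olsh e (r - 1 - a) k j *
          e (inl p) (inr l)) + ∑ p, rowRes e s i p * olsh e r k j * e (inl p) (inr l) := by
    intro i j k l
    rw [Finset.sum_range_succ']
    congr 1
    · refine Finset.sum_congr rfl fun a _ => ?_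
      rw [show a + 1 + s = a + (s + 1) by omega, show r + 1 - 1 - (a + 1) = r - 1 - a by omega]
    · simp
  rw [yangianDefect, he.comm_olsh_olsh, he.comm_olsh_olsh r (s + 1), h1, h2, h4, h4]
  abel

theorem IsGLSystem.yangian (he : IsGLSystem e) (r s : ℕ) (i j k l : Fin n) :
    yangianDefect (olsh e) r s i j k l = 0 := by
  have hswap : ∀ r s i j k l, yangianDefect (olsh e) r s i j k l =
      yangianDefect (olsh e) s r k l i j + (olsh e s k j * olsh e r i l - olsh e r i l * olsh e s k j
        + (olsh e s i l * olsh e r k j - olsh e r k j * olsh e s i l)) := by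
    intro r s i j k l
    simp only [yangianDefect]; abel
  have hzero : ∀ r i j k l, yangianDefect (olsh e) r 0 i j k l = 0 := by
    intro r i j k l
    have := he.odd_mul_olsh k l r i j
    simp only [yangianDefect, zero_add, olsh_one, olsh_zero, this]
    by_cases h : k = l <;> by_cases h1 : k = j <;> by_cases h2 : i = l <;>
      simp [h, h1, h2, eq_comm (a := l)]
  match s with
  | 0 => exact hzero r i j k l
  | s + 2 => exact he.yangian_of_two_le r s i j k l
  -- Exchanging the two factors reduces to second index r, at the price of commutators with elements
  -- of degree 1, which `odd_mul_olsh` evaluates.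
  | 1 =>
    have h1 := he.odd_mul_olsh k j r i l
    have h2 := he.odd_mul_olsh i l r k j
    have h5 : yangianDefect (olsh e) 1 r k l i j = 0 := by
      match r with
      | 0 => exact hzero _ _ _ _ _
      | 1 =>
        have h3 := he.odd_mul_olsh k l 2 i j
        have h4 := he.odd_mul_olsh i j 2 k l
        simp only [yangianDefect, olsh_one, Nat.reduceAdd, h3, h4, eq_comm (a := l),
          eq_comm (a := j)]
        abel
      | r + 2 => exact he.yangian_of_two_le _ _ _ _ _ _
    rw [hswap, h5]
    simp only [olsh_one, h1, h2, eq_comm (a := l), eq_comm (a := j)]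
    abel

end Resolvent

/-! ### Sums over subsets and intervals of a linear order -/

theorem _root_.Finset.sum_powerset_Ioi {α M : Type*} [LinearOrder α] [LocallyFiniteOrderTop α]
    [AddCommMonoid M] (p : α) (F : Finset α → M) :
    ∑ S ∈ (Finset.Ioi p).powerset, F S =
      F ∅ + ∑ q ∈ Finset.Ioi p, ∑ S ∈ (Finset.Ioi q).powerset, F (insert q S) := by
  rw [← Finset.add_sum_erase _ _ (Finset.empty_mem_powerset _)]
  congr 1
  rw [Finset.sum_sigma']
  symm
  refine Finset.sum_bij (fun x _ => insert x.1 x.2) ?_ ?_ ?_ (fun _ _ => rfl)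
  · rintro ⟨q, S⟩ h
    simp only [Finset.mem_sigma, Finset.mem_Ioi, Finset.mem_powerset] at h
    simp only [Finset.mem_erase, Finset.mem_powerset]
    refine ⟨Finset.insert_ne_empty _ _, ?_⟩
    intro r hr
    rcases Finset.mem_insert.1 hr with rfl | hr
    · exact Finset.mem_Ioi.2 h.1
    · exact Finset.mem_Ioi.2 (h.1.trans (Finset.mem_Ioi.1 (h.2 hr)))
  · rintro ⟨q, S⟩ h ⟨q', S'⟩ h' heq
    simp only [Finset.mem_sigma, Finset.mem_Ioi, Finset.mem_powerset] at h h' heq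
    have hq : q = q' := by
      have h1 : q ∈ insert q' S' := heq ▸ Finset.mem_insert_self q S
      have h2 : q' ∈ insert q S := heq ▸ Finset.mem_insert_self q' S'
      rcases Finset.mem_insert.1 h1 with h1 | h1
      · exact h1
      rcases Finset.mem_insert.1 h2 with h2 | h2
      · exact h2.symm
      exact absurd ((Finset.mem_Ioi.1 (h'.2 h1)).trans (Finset.mem_Ioi.1 (h.2 h2))) (lt_irrefl _)
    subst hq
    have hS : ∀ T : Finset α, T ⊆ Finset.Ioi q → q ∉ T := fun T hT hq =>
      lt_irrefl _ (Finset.mem_Ioi.1 (hT hq))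
    have := congrArg (fun T => T.erase q) heq
    simp only [Finset.erase_insert (hS _ h.2), Finset.erase_insert (hS _ h'.2)] at this
    rw [this]
  · intro T hT
    simp only [Finset.mem_erase, Finset.mem_powerset] at hT
    have hne := Finset.nonempty_iff_ne_empty.2 hT.1
    refine ⟨⟨T.min' hne, T.erase (T.min' hne)⟩, ?_, Finset.insert_erase (T.min'_mem hne)⟩
    simp only [Finset.mem_sigma, Finset.mem_powerset]
    refine ⟨hT.2 (T.min'_mem hne), fun r hr => Finset.mem_Ioi.2 ?_⟩
    exact lt_of_le_of_ne (T.min'_le _ (Finset.mem_of_mem_erase hr)) (Finset.ne_of_mem_erase hr).symm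

theorem _root_.Finset.sum_eq_Iio_add_Ioi {m : ℕ} {M : Type*} [AddCommMonoid M] (p : Fin m)
    (f : Fin m → M) :
    ∑ q, f q = ∑ q ∈ Finset.Iio p, f q + (f p + ∑ q ∈ Finset.Ioi p, f q) := by
  rw [← Finset.sum_insert (by simp), ← Finset.sum_union]
  · congr 1
    ext q
    rcases lt_trichotomy q p with h | h | h <;> simp [h, h.le]
  · rw [Finset.disjoint_left]
    intro q hq hq'
    have := Finset.mem_Iio.1 hq
    rcases Finset.mem_insert.1 hq' with rfl | h
    · exact lt_irrefl _ this
    · exact lt_asymm this (Finset.mem_Ioi.1 h)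

/-! ### Normalized lowering operators for `gl_m` -/

section Lowering

variable {m : ℕ} {W : Type*} [AddCommGroup W] [Module ℂ W]

/-- An action of `gl_m` on `W`, given by the operators of the matrix units. -/
def IsGLAction (g : Fin m → Fin m → Module.End ℂ W) : Prop :=
  ∀ i j k l, g i j * g k l =
    g k l * g i j + ((if j = k then g i l else 0) - if i = l then g k j else 0)

/-- The images of a highest vector of weight `ν` under the components of a covector operator. -/
structure IsLowFamily (g : Fin m → Fin m → Module.End ℂ W) (ν : Fin m → ℂ) (x : Fin m → W) :
    Prop where
  raise : ∀ i j p, i < j → g i j (x p) = if i = p then -x j else 0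
  weight : ∀ i p, g i i (x p) = (ν i - if i = p then 1 else 0) • x p

/-- The vector `E_{i₁ p} E_{i₂ i₁} ⋯ E_{i_s i_{s-1}} x_{i_s}`. -/
def pathVec (g : Fin m → Fin m → Module.End ℂ W) (x : Fin m → W) : Fin m → List (Fin m) → W
  | p, [] => x p
  | p, q :: l => g q p (pathVec g x q l)

/-- The value of `h_k - h_q` on vectors of weight `ν`. -/
def gap (ν : Fin m → ℂ) (k q : Fin m) : ℂ := (ν k - (k : ℕ)) - (ν q - (q : ℕ))

/-- The normalized lowering operator applied to a family of vectors; its value at `p = k` is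
a highest vector if `x` is a low family. -/
noncomputable def lowered (g : Fin m → Fin m → Module.End ℂ W) (ν : Fin m → ℂ) (k : Fin m)
    (x : Fin m → W) (p : Fin m) : W :=
  ∑ S ∈ (Finset.Ioi p).powerset,
    (∏ q ∈ S, (gap ν k q)⁻¹) • pathVec g x p (S.sort (· ≤ ·))

variable {g : Fin m → Fin m → Module.End ℂ W} {ν : Fin m → ℂ} {k : Fin m} {x : Fin m → W}

@[simp] theorem gap_self : gap ν k k = 0 := sub_self _

/-- Group the subsets by their least element, the first step of the path. The properties of
`lowered` are then proved by descending induction on p, which is why it is defined for all p and not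
only for p = k. -/
theorem lowered_rec (p : Fin m) :
    lowered g ν k x p =
      x p + ∑ q ∈ Finset.Ioi p, (gap ν k q)⁻¹ • g q p (lowered g ν k x q) := by
  rw [lowered, Finset.sum_powerset_Ioi]
  congr 1
  · simp [pathVec]
  · refine Finset.sum_congr rfl fun q _ => ?_
    rw [lowered, map_sum, Finset.smul_sum]
    refine Finset.sum_congr rfl fun S hS => ?_
    have hS := Finset.mem_powerset.1 hS
    have hq : q ∉ S := fun h => lt_irrefl _ (Finset.mem_Ioi.1 (hS h))
    rw [Finset.prod_insert hq, Finset.sort_insert _ (fun b hb => (Finset.mem_Ioi.1 (hS hb)).le) hq,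
      pathVec, map_smul, smul_smul]

theorem pathVec_map {W' : Type*} [AddCommGroup W'] [Module ℂ W']
    {g' : Fin m → Fin m → Module.End ℂ W'} (φ : W →ₗ[ℂ] W')
    (hφ : ∀ i j w, φ (g i j w) = g' i j (φ w)) (p : Fin m) (l : List (Fin m)) :
    φ (pathVec g x p l) = pathVec g' (fun q => φ (x q)) p l := by
  induction l generalizing p with
  | nil => rfl
  | cons q l ih => rw [pathVec, hφ, ih, pathVec]

theorem lowered_map {W' : Type*} [AddCommGroup W'] [Module ℂ W']
    {g' : Fin m → Fin m → Module.End ℂ W'} (φ : W →ₗ[ℂ] W')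
    (hφ : ∀ i j w, φ (g i j w) = g' i j (φ w)) (p : Fin m) :
    φ (lowered g ν k x p) = lowered g' ν k (fun q => φ (x q)) p := by
  simp only [lowered, map_sum, map_smul, pathVec_map φ hφ]

theorem lowered_mem (N : Submodule ℂ W) (hN : ∀ i j, ∀ w ∈ N, g i j w ∈ N) (hx : ∀ p, x p ∈ N)
    (p : Fin m) : lowered g ν k x p ∈ N := by
  have key : ∀ l p, pathVec g x p l ∈ N := by
    intro l
    induction l with
    | nil => exact hx
    | cons q l ih => exact fun p => hN _ _ _ (ih q)
  exact N.sum_mem fun S _ => N.smul_mem _ (key _ _)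

theorem lowered_add (x y : Fin m → W) (p : Fin m) :
    lowered g ν k (fun q => x q + y q) p = lowered g ν k x p + lowered g ν k y p := by
  induction p using WellFoundedGT.induction with
  | _ p ih =>
    rw [lowered_rec, lowered_rec (x := x), lowered_rec (x := y)]
    rw [Finset.sum_congr rfl fun q hq => by rw [ih q (Finset.mem_Ioi.1 hq), map_add, smul_add],
      Finset.sum_add_distrib]
    abel

theorem lowered_smul (c : ℂ) (x : Fin m → W) (p : Fin m) :
    lowered g ν k (fun q => c • x q) p = c • lowered g ν k x p := by
  induction p using WellFoundedGT.induction with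
  | _ p ih =>
    rw [lowered_rec, lowered_rec (x := x), smul_add, Finset.smul_sum]
    rw [Finset.sum_congr rfl fun q hq => by
      rw [ih q (Finset.mem_Ioi.1 hq), map_smul, smul_comm]]

theorem lowered_neg (x : Fin m → W) (p : Fin m) :
    lowered g ν k (fun q => -x q) p = -lowered g ν k x p := by
  simpa using lowered_smul (g := g) (ν := ν) (k := k) (-1) x p

theorem lowered_sub (x y : Fin m → W) (p : Fin m) :
    lowered g ν k (fun q => x q - y q) p = lowered g ν k x p - lowered g ν k y p := by
  simp only [sub_eq_add_neg, lowered_add, lowered_neg]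

theorem lowered_zero (p : Fin m) : lowered g ν k (fun _ => 0) p = 0 := by
  simpa using lowered_smul (g := g) (ν := ν) (k := k) 0 (fun _ => 0) p

theorem IsLowFamily.weight_lowered (hg : IsGLAction g) (hx : IsLowFamily g ν x) (i p : Fin m) :
    g i i (lowered g ν k x p) = (ν i - if i = p then 1 else 0) • lowered g ν k x p := by
  induction p using WellFoundedGT.induction with
  | _ p ih =>
    rw [lowered_rec, map_add, hx.weight, map_sum, smul_add, Finset.smul_sum]
    congr 1
    refine Finset.sum_congr rfl fun q hq => ?_
    rw [map_smul, smul_comm]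
    congr 1
    have := congrArg (fun T => T (lowered g ν k x q)) (hg i i q p)
    simp only [Module.End.mul_apply, LinearMap.add_apply, LinearMap.sub_apply] at this
    rw [this, ih q (Finset.mem_Ioi.1 hq), map_smul]
    by_cases h1 : i = q
    · subst h1
      have h2 : i ≠ p := (Finset.mem_Ioi.1 hq).ne'
      simp [h2, sub_smul]
    · by_cases h2 : i = p
      · subst h2
        simp [h1, sub_smul]
        abel
      · simp [h1, h2]

/-- The coefficient contains gap ν k p, which is zero at p = k; this makes the lowered vector
highest. The formula for p > k is what the descending induction needs. -/
theorem IsLowFamily.raise_lowered (hg : IsGLAction g) (hx : IsLowFamily g ν x) (p : Fin m)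
    (hgap : ∀ q, p < q → gap ν k q ≠ 0) (i j : Fin m) (hij : i < j) :
    g i j (lowered g ν k x p) =
      if i = p then -(gap ν k p * (gap ν k j)⁻¹) • lowered g ν k x j else 0 := by
  induction p using WellFoundedGT.induction generalizing i j with
  | _ p ih =>
    have ih : ∀ q, p < q → ∀ i j, i < j → g i j (lowered g ν k x q) =
      if i = q then -(gap ν k q * (gap ν k j)⁻¹) • lowered g ν k x j else 0 := fun q hq =>
        ih q hq fun r hr => hgap r (hq.trans hr)
    set y := lowered g ν k x with hy
    have hterm : ∀ q ∈ Finset.Ioi p, g i j ((gap ν k q)⁻¹ • g q p (y q)) =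
        (if i = q then -(gap ν k j)⁻¹ • g i p (y j) else 0)
        + (if j = q then (gap ν k j)⁻¹ • g i p (y j) else 0)
        - (if i = p then (gap ν k q)⁻¹ • g q j (y q) else 0) := by
      intro q hq
      have hq := Finset.mem_Ioi.1 hq
      have := congrArg (fun T => T (y q)) (hg i j q p)
      simp only [Module.End.mul_apply, LinearMap.add_apply, LinearMap.sub_apply] at this
      rw [map_smul, this, ih q hq i j hij]
      have h0 := hgap q hq
      by_cases h1 : i = q
      · subst h1
        have h2 : i ≠ p := hq.ne'
        have h3 : j ≠ i := hij.ne'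
        simp [h2, h3, smul_smul, inv_mul_cancel_left₀ h0]
      · by_cases h2 : i = p
        · subst h2
          by_cases h3 : j = q <;> simp [h1, h3, smul_sub]
        · by_cases h3 : j = q <;> simp [h1, h2, h3]
    have h1 : g i j (y p) = (if i = p then -x j else 0)
        + ((if p < i then -(gap ν k j)⁻¹ • g i p (y j) else 0)
        + (if p < j then (gap ν k j)⁻¹ • g i p (y j) else 0)
        - (if i = p then ∑ q ∈ Finset.Ioi p, (gap ν k q)⁻¹ • g q j (y q) else 0)) := by
      rw [hy, lowered_rec, map_add, hx.raise _ _ _ hij, map_sum, ← hy, Finset.sum_congr rfl hterm,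
        Finset.sum_sub_distrib, Finset.sum_add_distrib]
      simp only [Finset.sum_ite_eq, Finset.mem_Ioi]
      congr 2
      split_ifs <;> simp
    rw [h1]
    rcases lt_trichotomy i p with h | h | h
    · by_cases hp : p < j
      · simp [h.ne, hp, ih j hp i p h, hij.ne]
      · simp [h.ne, h.le, hp]
    · subst h
      have h0 := hgap j hij
      -- For i < q < j the inductive formula gives the same multiple of y_j each time, q = j gives
      -- the weight, and the terms q > j form the recursion for y_j.
      have hsum : ∑ q ∈ Finset.Ioi i, (gap ν k q)⁻¹ • g q j (y q) =
          -(((j : ℕ) - (i : ℕ) - 1 : ℂ) * (gap ν k j)⁻¹) • y j +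
            ((gap ν k j)⁻¹ * (ν j - 1)) • y j + (y j - x j) := by
        have hsplit : Finset.Ioi i = Finset.Ioo i j ∪ (insert j (Finset.Ioi j)) := by
          ext q
          simp only [Finset.mem_Ioi, Finset.mem_union, Finset.mem_Ioo, Finset.mem_insert]
          constructor
          · intro hq
            rcases lt_trichotomy q j with h | h | h <;> simp [h, hq]
          · rintro (h | h | h)
            · exact h.1
            · exact h ▸ hij
            · exact hij.trans h
        have hdisj : Disjoint (Finset.Ioo i j) (insert j (Finset.Ioi j)) := by
          rw [Finset.disjoint_left]
          intro q hq hq'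
          have := (Finset.mem_Ioo.1 hq).2
          rcases Finset.mem_insert.1 hq' with rfl | h
          · exact lt_irrefl _ this
          · exact lt_asymm this (Finset.mem_Ioi.1 h)
        have hyj : y j - x j = ∑ q ∈ Finset.Ioi j, (gap ν k q)⁻¹ • g q j (y q) := by
          rw [hy, lowered_rec (p := j), add_sub_cancel_left]
        have hIoo : ∀ q ∈ Finset.Ioo i j, (gap ν k q)⁻¹ • g q j (y q) = -(gap ν k j)⁻¹ • y j := by
          intro q hq
          obtain ⟨hq1, hq2⟩ := Finset.mem_Ioo.1 hq
          rw [ih q hq1 q j hq2, if_pos rfl, smul_smul, mul_neg, ← mul_assoc,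
            inv_mul_cancel₀ (hgap q hq1), one_mul]
        rw [hsplit, Finset.sum_union hdisj, Finset.sum_insert (by simp), ← hyj,
          Finset.sum_congr rfl hIoo, Finset.sum_const, Fin.card_Ioo, hy,
          hx.weight_lowered hg, if_pos rfl, ← hy, smul_smul, ← Nat.cast_smul_eq_nsmul ℂ, smul_smul,
          add_assoc]
        congr 2
        have : (i : ℕ) + 1 ≤ (j : ℕ) := hij
        rw [Nat.sub_sub, Nat.cast_sub this]
        push_cast
        ring
      rw [hsum, hy, hx.weight_lowered hg, ← hy, if_pos rfl, if_neg (lt_irrefl _), if_pos hij,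
        if_pos rfl, if_pos rfl, if_neg hij.ne]
      have h4 : gap ν k i = gap ν k j - (ν i - (i : ℕ) - (ν j - (j : ℕ))) := by
        simp only [gap]; ring
      rw [h4]
      match_scalars
      · ring
      · field_simp
        ring
    · have hp : p < j := h.trans hij
      simp [h.ne', h, hp]

/-- For x_p = Y_p η the left side is ∑_q Y_q E_qp η: moving each E_qp to the left of Y_q costs one
Y_p η. On a low family the part q ≤ p is scalar. -/
theorem IsLowFamily.shift_eq (hx : IsLowFamily g ν x) (p : Fin m) :
    (m : ℂ) • x p + ∑ q, g q p (x q) =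
      ((m : ℂ) + (ν p - (p : ℕ)) - 1) • x p + ∑ q ∈ Finset.Ioi p, g q p (x q) := by
  rw [Finset.sum_eq_Iio_add_Ioi p, hx.weight, Finset.sum_congr rfl fun q hq => by
    rw [hx.raise q p q (Finset.mem_Iio.1 hq), if_pos rfl], Finset.sum_const, Fin.card_Iio,
    if_pos rfl, ← Nat.cast_smul_eq_nsmul ℂ]
  module

/-- The eigenvalue of the matrix `E` on highest vectors of weight `ν - ε_k`. -/
def content (ν : Fin m → ℂ) (k : Fin m) : ℂ := (m : ℂ) + (ν k - (k : ℕ)) - 1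

/-- Lowering turns right multiplication of the covector by E into a scalar, up to an error
proportional to gap ν k p. The error disappears at p = k, but the induction has to carry it. -/
theorem IsLowFamily.lowered_shift (hx : IsLowFamily g ν x) (p : Fin m)
    (hgap : ∀ q, p < q → gap ν k q ≠ 0) :
    lowered g ν k (fun p => (m : ℂ) • x p + ∑ q, g q p (x q)) p =
      content ν k • lowered g ν k x p - gap ν k p • x p := by
  induction p using WellFoundedGT.induction with
  | _ p ih =>
    have hterm : ∀ q ∈ Finset.Ioi p, (gap ν k q)⁻¹ • g q p (lowered g ν k
        (fun p => (m : ℂ) • x p + ∑ q, g q p (x q)) q) =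
        content ν k • (gap ν k q)⁻¹ • g q p (lowered g ν k x q) - g q p (x q) := by
      intro q hq
      rw [ih q (Finset.mem_Ioi.1 hq) fun r hr => hgap r ((Finset.mem_Ioi.1 hq).trans hr),
        map_sub, map_smul, map_smul, smul_sub, inv_smul_smul₀ (hgap q (Finset.mem_Ioi.1 hq)),
        smul_comm]
    rw [lowered_rec, hx.shift_eq, lowered_rec (x := x) (p := p), Finset.sum_congr rfl hterm,
      Finset.sum_sub_distrib, ← Finset.smul_sum, gap, content]
    module

/-- Highest vectors of weight `ν`. -/
structure IsHighest (g : Fin m → Fin m → Module.End ℂ W) (ν : Fin m → ℂ) (w : W) : Prop where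
  raise : ∀ i j, i < j → g i j w = 0
  weight : ∀ i, g i i w = ν i • w

theorem IsLowFamily.isHighest_lowered (hg : IsGLAction g) (hx : IsLowFamily g ν x)
    (hgap : ∀ q, k < q → gap ν k q ≠ 0) :
    IsHighest g (ν - Pi.single k 1) (lowered g ν k x k) where
  raise i j hij := by rw [hx.raise_lowered hg k hgap i j hij]; simp
  weight i := by rw [hx.weight_lowered hg]; simp [Pi.single_apply]

theorem IsLowFamily.lowered_shift_self (hx : IsLowFamily g ν x)
    (hgap : ∀ q, k < q → gap ν k q ≠ 0) :
    lowered g ν k (fun p => (m : ℂ) • x p + ∑ q, g q p (x q)) k =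
      content ν k • lowered g ν k x k := by
  rw [hx.lowered_shift k hgap, gap_self, zero_smul, sub_zero]

end Lowering

/-! ### Anticommutation of lowering operators with equal index -/

section Anticommutation

variable {m : ℕ} {V : Type*} [AddCommGroup V] [Module ℂ V]

/-- A family of operators transforming as the components of a covector. -/
def IsCovector (g : Fin m → Fin m → Module.End ℂ V) (Y : Fin m → Module.End ℂ V) : Prop :=
  ∀ i j p v, g i j (Y p v) = Y p (g i j v) - if i = p then Y j v else 0

/-- The action of `gl_m` on the tensor product of `V` with the dual of the vector
representation. -/
def colAction (g : Fin m → Fin m → Module.End ℂ V) (i j : Fin m) :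
    Module.End ℂ (Fin m → V) where
  toFun v p := g i j (v p) - if p = j then v i else 0
  map_add' v w := by
    funext p
    by_cases h : p = j <;> simp [h]
    abel
  map_smul' c v := by
    funext p
    by_cases h : p = j <;> simp [h, smul_sub]

/-- The universal form of the lowering operators: `lowered g ν k (Y • η) k` is the contraction of
this column with `Y`, for every covector `Y`. -/
noncomputable def univVec (g : Fin m → Fin m → Module.End ℂ V) (ν : Fin m → ℂ) (k : Fin m)
    (η : V) : Fin m → V :=
  lowered (colAction g) ν k (fun p => Pi.single p η) k

variable {g : Fin m → Fin m → Module.End ℂ V} {ν : Fin m → ℂ} {k : Fin m} {η : V}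
  {X Y : Fin m → Module.End ℂ V}

theorem colAction_apply (i j p : Fin m) (v : Fin m → V) :
    colAction g i j v p = g i j (v p) - if p = j then v i else 0 := rfl

theorem IsGLAction.apply (hg : IsGLAction g) (i j k l : Fin m) (v : V) :
    g i j (g k l v) = g k l (g i j v) + ((if j = k then g i l v else 0) -
      if i = l then g k j v else 0) := by
  have := congrArg (fun T => T v) (hg i j k l)
  simp only [Module.End.mul_apply, LinearMap.add_apply, LinearMap.sub_apply] at this
  rw [this]
  by_cases h1 : j = k <;> by_cases h2 : i = l <;> simp [h1, h2]

theorem IsGLAction.colAction (hg : IsGLAction g) : IsGLAction (colAction g) := by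
  intro i j k l
  refine LinearMap.ext fun v => funext fun p => ?_
  have h1 : ∀ w : Fin m → V, ((if j = k then CovariantYangian.colAction g i l else 0) w) p =
      if j = k then g i l (w p) - (if p = l then w i else 0) else 0 := by
    intro w; split_ifs <;> simp_all [colAction_apply]
  have h2 : ∀ w : Fin m → V, ((if i = l then CovariantYangian.colAction g k j else 0) w) p =
      if i = l then g k j (w p) - (if p = j then w k else 0) else 0 := by
    intro w; split_ifs <;> simp_all [colAction_apply]
  simp only [Module.End.mul_apply, LinearMap.add_apply, LinearMap.sub_apply, Pi.add_apply,
    Pi.sub_apply, h1, h2]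
  simp only [colAction_apply, map_sub, hg.apply i j k l]
  have h3 : ∀ (T : Module.End ℂ V) (c : Prop) [Decidable c] (w : V),
      T (if c then w else 0) = if c then T w else 0 := by
    intro T c _ w; split_ifs <;> simp
  simp only [h3, eq_comm (a := k) (b := j)]
  split_ifs <;> abel

theorem IsHighest.isLowFamily (hη : IsHighest g ν η) (hY : IsCovector g Y) :
    IsLowFamily g ν (fun p => Y p η) where
  raise i j p hij := by
    rw [hY, hη.raise i j hij, map_zero, zero_sub]; split_ifs <;> simp
  weight i p := by
    rw [hY, hη.weight i, map_smul]
    by_cases h : i = p <;> simp [h, sub_smul]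

theorem IsHighest.isLowFamily_single (hη : IsHighest g ν η) :
    IsLowFamily (colAction g) ν (fun p => Pi.single p η) where
  raise i j p hij := by
    funext s
    rw [colAction_apply]
    by_cases hs : s = p
    · subst hs
      by_cases h : i = s
      · subst h; simp [hη.raise i j hij, hij.ne]
      · simp [hη.raise i j hij, h]
    · by_cases h : i = p
      · subst h
        by_cases h' : s = j
        · subst h'; simp [hs]
        · simp [hs, h']
      · simp [hs, h]
  weight i p := by
    funext s
    rw [colAction_apply]
    by_cases hs : s = p
    · subst hs
      by_cases h : i = s
      · subst h; simp [hη.weight, sub_smul]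
      · simp [hη.weight, h, Ne.symm h]
    · by_cases h : i = p
      · subst h; simp [hs]
      · by_cases h' : s = i <;> simp [hs, h, h']

/-- Contraction with a covector. -/
def contract (Y : Fin m → Module.End ℂ V) : (Fin m → V) →ₗ[ℂ] V :=
  ∑ p, Y p ∘ₗ LinearMap.proj p

theorem contract_apply (v : Fin m → V) : contract Y v = ∑ p, Y p (v p) := by
  simp [contract]

theorem IsCovector.contract_colAction (hY : IsCovector g Y) (i j : Fin m) (v : Fin m → V) :
    contract Y (colAction g i j v) = g i j (contract Y v) := by
  simp only [contract_apply, colAction_apply, map_sub, map_sum, hY i j, Finset.sum_sub_distrib,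
    Finset.sum_ite_eq, Finset.mem_univ, if_true]
  congr 1
  rw [Finset.sum_eq_single j] <;> simp +contextual

/-- Contraction with Y intertwines the action on columns with the action on V, so it commutes with
lowering. Thus Y is separated from a column that does not depend on it. -/
theorem IsCovector.lowered_eq (hY : IsCovector g Y) :
    lowered g ν k (fun p => Y p η) k = ∑ p, Y p (univVec g ν k η p) := by
  rw [← contract_apply, univVec, lowered_map (g' := g) (contract Y) hY.contract_colAction]
  congr 1
  funext q
  rw [contract_apply, Finset.sum_eq_single q] <;> simp +contextual

theorem univVec_raise (hg : IsGLAction g) (hη : IsHighest g ν η)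
    (hgap : ∀ q, k < q → gap ν k q ≠ 0) (i j p : Fin m) (hij : i < j) :
    g i j (univVec g ν k η p) = if p = j then univVec g ν k η i else 0 := by
  have := congrFun ((hη.isLowFamily_single.isHighest_lowered hg.colAction hgap).raise i j hij) p
  rw [colAction_apply, Pi.zero_apply, sub_eq_zero] at this
  exact this

theorem univVec_weight (hg : IsGLAction g) (hη : IsHighest g ν η)
    (hgap : ∀ q, k < q → gap ν k q ≠ 0) (i p : Fin m) :
    g i i (univVec g ν k η p) = ((ν - Pi.single k 1 : Fin m → ℂ) i) • univVec g ν k η p +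
      if p = i then univVec g ν k η i else 0 := by
  have := congrFun ((hη.isLowFamily_single.isHighest_lowered hg.colAction hgap).weight i) p
  rw [colAction_apply, sub_eq_iff_eq_add] at this
  exact this

/-- The matrix `E` acting on columns. -/
def matAction (g : Fin m → Fin m → Module.End ℂ V) : Module.End ℂ (Fin m → V) :=
  LinearMap.pi fun s => ∑ t, g s t ∘ₗ LinearMap.proj t

theorem matAction_apply (v : Fin m → V) (s : Fin m) : matAction g v s = ∑ t, g s t (v t) := by
  simp [matAction]

theorem IsGLAction.matAction_colAction (hg : IsGLAction g) (i j : Fin m) (v : Fin m → V) :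
    matAction g (CovariantYangian.colAction g i j v) =
      CovariantYangian.colAction g i j (matAction g v) := by
  funext s
  simp only [matAction_apply, colAction_apply, map_sub, map_sum, hg.apply i j s,
    Finset.sum_add_distrib, Finset.sum_sub_distrib, Finset.sum_ite_eq, Finset.mem_univ, if_true]
  have : ∑ t, g s t (if t = j then v i else 0) = g s j (v i) := by
    rw [Finset.sum_eq_single j] <;> simp +contextual
  rw [this]
  by_cases h : s = j
  · subst h; simp; abel
  · simp [h, Ne.symm h]; abel

/-- The matrix E commutes with the action on columns, and on the columns with single entry η it is
the shift of `lowered_shift_self`. -/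
theorem univVec_eigen (hg : IsGLAction g) (hη : IsHighest g ν η)
    (hgap : ∀ q, k < q → gap ν k q ≠ 0) (s : Fin m) :
    ∑ t, g s t (univVec g ν k η t) = content ν k • univVec g ν k η s := by
  have h := hη.isLowFamily_single.lowered_shift_self hgap
  have h1 : (fun p => (m : ℂ) • (Pi.single p η : Fin m → V) +
      ∑ q, colAction g q p (Pi.single q η : Fin m → V)) = fun p => matAction g (Pi.single p η) := by
    funext p s
    simp only [Pi.add_apply, Pi.smul_apply, Finset.sum_apply, colAction_apply, matAction_apply,
      Finset.sum_sub_distrib, Pi.single_eq_same]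
    have h2 : ∑ q, g q p ((Pi.single q η : Fin m → V) s) = g s p η := by
      rw [Finset.sum_eq_single s] <;> simp +contextual [Ne.symm]
    have h3 : ∑ t, g s t ((Pi.single p η : Fin m → V) t) = g s p η := by
      rw [Finset.sum_eq_single p] <;> simp +contextual
    rw [h2, h3]
    by_cases h : s = p
    · subst h; simp [Nat.cast_smul_eq_nsmul]
    · simp [h]
  rw [h1, ← lowered_map (matAction g) hg.matAction_colAction] at h
  have := congrFun h s
  rwa [matAction_apply] at this

theorem univVec_mem (N : Submodule ℂ V) (hN : ∀ i j, ∀ w ∈ N, g i j w ∈ N) (hη : η ∈ N)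
    (p : Fin m) : univVec g ν k η p ∈ N := by
  have : univVec g ν k η ∈ Submodule.pi Set.univ fun _ : Fin m => N := by
    refine lowered_mem _ ?_ ?_ _
    · intro i j w hw
      simp only [Submodule.mem_pi, Set.mem_univ, forall_true_left] at hw ⊢
      intro p
      rw [colAction_apply]
      refine N.sub_mem (hN _ _ _ (hw p)) ?_
      split_ifs
      exacts [hw i, N.zero_mem]
    · intro p
      simp only [Submodule.mem_pi, Set.mem_univ, forall_true_left]
      intro s
      by_cases h : s = p
      · subst h; simpa
      · simp [h]
  simpa using this p

/-- The covector `Y (E - c)`. -/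
def shiftCov (g : Fin m → Fin m → Module.End ℂ V) (c : ℂ) (Y : Fin m → Module.End ℂ V) :
    Fin m → Module.End ℂ V :=
  fun p => ∑ t, Y t * g t p - c • Y p

theorem shiftCov_apply (c : ℂ) (p : Fin m) (v : V) :
    shiftCov g c Y p v = ∑ t, Y t (g t p v) - c • Y p v := by
  simp [shiftCov, LinearMap.sum_apply]

theorem IsCovector.shiftCov (hg : IsGLAction g) (hY : IsCovector g Y) (c : ℂ) :
    IsCovector g (shiftCov g c Y) := by
  intro i j p v
  simp only [shiftCov_apply, map_sub, map_sum, map_smul, hY i j, hg.apply i j, map_add,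
    Finset.sum_sub_distrib, Finset.sum_add_distrib, Finset.sum_ite_eq, Finset.mem_univ, if_true]
  have h1 : ∑ t, Y t (if j = t then g i p v else 0) = Y j (g i p v) := by
    rw [Finset.sum_eq_single j] <;> simp +contextual [Ne.symm]
  rw [h1]
  by_cases h : i = p <;> simp [h, smul_sub]; abel

/-- The covectors `Y ∏ (E - c_q)` with `c_q` running over the last `s` of the characteristic roots
of `E` on a highest weight module. -/
def charCov (g : Fin m → Fin m → Module.End ℂ V) (ν : Fin m → ℂ) (Y : Fin m → Module.End ℂ V) :
    ∀ s : ℕ, s ≤ m → Fin m → Module.End ℂ V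
  | 0, _ => Y
  | s + 1, h => shiftCov g (content ν ⟨m - 1 - s, by omega⟩) (charCov g ν Y s (by omega))

theorem IsCovector.charCov (hg : IsGLAction g) (hY : IsCovector g Y) (s : ℕ) (hs : s ≤ m) :
    IsCovector g (charCov g ν Y s hs) := by
  induction s with
  | zero => exact hY
  | succ s ih => exact (ih (by omega)).shiftCov hg _

/-- The characteristic identity, by triangularity: each factor E − c_r kills one more component on
η, from the last component to the first. If Z_q η = 0 for q > r, then Z_q E_qr η = Z_r η, and these
m − 1 − r terms with the weight ν_r add up to the root c_r. -/
theorem IsHighest.charCov_apply (hg : IsGLAction g) (hη : IsHighest g ν η) (hY : IsCovector g Y)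
    (s : ℕ) (hs : s ≤ m) (r : Fin m) (hr : m ≤ r + s) : charCov g ν Y s hs r η = 0 := by
  induction s generalizing r with
  | zero => omega
  | succ s ih =>
    have ih := ih (by omega)
    have hZ := hY.charCov (ν := ν) hg s (by omega)
    rw [charCov, shiftCov_apply, Finset.sum_eq_Iio_add_Ioi r]
    set Z := CovariantYangian.charCov g ν Y s (by omega) with hZdef
    have h1 : ∑ q ∈ Finset.Iio r, Z q (g q r η) = 0 :=
      Finset.sum_eq_zero fun q hq => by rw [hη.raise q r (Finset.mem_Iio.1 hq), map_zero]
    have h2 : ∑ q ∈ Finset.Ioi r, Z q (g q r η) = ((m : ℂ) - 1 - (r : ℕ)) • Z r η := by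
      have : ∀ q ∈ Finset.Ioi r, Z q (g q r η) = Z r η := by
        intro q hq
        have hq := Finset.mem_Ioi.1 hq
        have h3 := hZ q r q η
        rw [ih q (by have : (r : ℕ) < q := hq; omega), map_zero, if_pos rfl] at h3
        exact (sub_eq_zero.1 h3.symm)
      rw [Finset.sum_congr rfl this, Finset.sum_const, Fin.card_Ioi, ← Nat.cast_smul_eq_nsmul ℂ,
        Nat.cast_sub (by have := r.2; omega), Nat.cast_sub (by have := r.2; omega)]
      push_cast
      rfl
    rw [h1, h2, hη.weight, map_smul]
    by_cases hr' : m ≤ r + s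
    · rw [ih r hr']; simp
    · have : (⟨m - 1 - s, by omega⟩ : Fin m) = r := Fin.ext (by simp; omega)
      rw [this, content]
      module

/-- The common kernel of the components of a covector is stable under `gl_m`. It contains η, hence
every entry of the universal column. -/
theorem IsHighest.charCov_univVec (hg : IsGLAction g) (hη : IsHighest g ν η)
    (hY : IsCovector g Y) (q p : Fin m) : charCov g ν Y m le_rfl q (univVec g ν k η p) = 0 := by
  let N : Submodule ℂ V := ⨅ q, LinearMap.ker (charCov g ν Y m le_rfl q)
  have hN : ∀ v, v ∈ N ↔ ∀ q, charCov g ν Y m le_rfl q v = 0 := by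
    intro v; simp [N, Submodule.mem_iInf]
  refine (hN _).1 (univVec_mem N ?_ ?_ p) q
  · intro i j w hw
    rw [hN] at hw ⊢
    intro q
    have := hY.charCov (ν := ν) hg m le_rfl i j q w
    rw [hw q, hw j, map_zero, ite_self, sub_zero] at this
    exact this.symm
  · exact (hN _).2 fun q => hη.charCov_apply hg hY m le_rfl q (by omega)

/-- The two orders of contracting a pair of covectors, applied to the doubly lowered vector. -/
noncomputable def lowerStraight (g : Fin m → Fin m → Module.End ℂ V) (ν : Fin m → ℂ) (k : Fin m)
    (η : V) (X Y : Fin m → Module.End ℂ V) : V :=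
  lowered g (ν - Pi.single k 1) k (fun q => ∑ p, X q (Y p (univVec g ν k η p))) k

/-- The flipped contraction of a pair of covectors, applied to the doubly lowered vector. -/
noncomputable def lowerFlip (g : Fin m → Fin m → Module.End ℂ V) (ν : Fin m → ℂ) (k : Fin m)
    (η : V) (X Y : Fin m → Module.End ℂ V) : V :=
  lowered g (ν - Pi.single k 1) k (fun q => ∑ p, X p (Y q (univVec g ν k η p))) k

theorem lowerStraight_shift (hg : IsGLAction g) (hη : IsHighest g ν η)
    (hgap : ∀ q, k < q → gap ν k q ≠ 0) (c : ℂ) :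
    lowerStraight g ν k η X (shiftCov g c Y) = (content ν k - c) • lowerStraight g ν k η X Y := by
  rw [lowerStraight, lowerStraight, ← lowered_smul]
  congr 1
  funext q
  simp only [← map_sum]
  rw [← map_smul]
  congr 1
  simp only [shiftCov_apply, Finset.sum_sub_distrib]
  rw [Finset.sum_comm]
  simp only [← map_sum, univVec_eigen hg hη hgap, map_smul, ← Finset.smul_sum, sub_smul]

theorem isLowFamily_flip (hg : IsGLAction g) (hη : IsHighest g ν η)
    (hgap : ∀ q, k < q → gap ν k q ≠ 0) (hX : IsCovector g X) (hY : IsCovector g Y) :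
    IsLowFamily g (ν - Pi.single k 1) (fun q => ∑ p, X p (Y q (univVec g ν k η p))) where
  raise i j q hij := by
    simp only [map_sum, hX i j, hY i j, map_sub, univVec_raise hg hη hgap i j _ hij,
      Finset.sum_sub_distrib, Finset.sum_ite_eq, Finset.mem_univ, if_true]
    rw [Finset.sum_eq_single j]
    · by_cases h : i = q <;> simp [h]
    · intro b _ hb; simp [hb]
    · simp
  weight i q := by
    simp only [map_sum, hX i i, hY i i, map_sub, univVec_weight hg hη hgap i, map_add, map_smul,
      Finset.sum_sub_distrib, Finset.sum_add_distrib, Finset.sum_ite_eq, Finset.mem_univ, if_true,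
      ← Finset.smul_sum]
    have : ∑ p, X p (Y q (if p = i then univVec g ν k η i else 0)) =
        X i (Y q (univVec g ν k η i)) := by
      rw [Finset.sum_eq_single i] <;> simp +contextual
    rw [this, sub_smul]
    by_cases h : i = q <;> simp [h]
    abel

theorem content_sub_single : content (ν - Pi.single k 1) k = content ν k - 1 := by
  simp [content]; ring

theorem gap_sub_single {q : Fin m} (hq : q ≠ k) :
    gap (ν - Pi.single k 1) k q = gap ν k q - 1 := by
  simp [gap, hq]; ring

/-- In the flipped contraction E meets the free index, so it acts by the content for the weight ν −
ε_k, which is one less. Moving E to the left past X_p produces the straight contraction as an extra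
term. -/
theorem lowerFlip_shift (hg : IsGLAction g) (hη : IsHighest g ν η)
    (hgap : ∀ q, k < q → gap ν k q ≠ 0) (hgap' : ∀ q, k < q → gap ν k q ≠ 1)
    (hX : IsCovector g X) (hY : IsCovector g Y) (c : ℂ) :
    lowerFlip g ν k η X (shiftCov g c Y) =
      (content ν k - 1 - c) • lowerFlip g ν k η X Y + lowerStraight g ν k η X Y := by
  have h := (isLowFamily_flip hg hη hgap hX hY).lowered_shift_self (k := k) (by
    intro q hq
    rw [gap_sub_single hq.ne', sub_ne_zero]
    exact hgap' q hq)
  rw [content_sub_single] at h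
  rw [sub_smul, lowerFlip, lowerFlip, ← h, lowerStraight, ← lowered_smul, ← lowered_sub,
    ← lowered_add]
  congr 1
  funext q
  simp only [shiftCov_apply, map_sub, map_sum, map_smul, Finset.sum_sub_distrib,
    ← Finset.smul_sum, hX _ q, hY _ q]
  rw [Finset.sum_comm]
  simp only [Finset.sum_const, Finset.card_univ, Fintype.card_fin,
    Finset.sum_ite_eq, Finset.mem_univ, if_true]
  simp only [Nat.cast_smul_eq_nsmul]
  abel

/-- Write F and S for the flipped and straight vectors and κ for the content. Replacing Y by Y(E −
c) gives (κ − 1 − c)F + S and (κ − c)S; if these agree and c ≠ κ − 1, then F = S. Both vanish once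
all characteristic factors are included, and these are removed one by one. -/
theorem lowerFlip_eq_lowerStraight (hg : IsGLAction g) (hη : IsHighest g ν η)
    (hgap : ∀ q, q ≠ k → gap ν k q ≠ 0) (hgap' : ∀ q, q ≠ k → gap ν k q ≠ 1)
    (hX : IsCovector g X) (hY : IsCovector g Y) :
    lowerFlip g ν k η X Y = lowerStraight g ν k η X Y := by
  have hg0 : ∀ q, k < q → gap ν k q ≠ 0 := fun q hq => hgap q hq.ne'
  have hg1 : ∀ q, k < q → gap ν k q ≠ 1 := fun q hq => hgap' q hq.ne'
  have key : ∀ s (hs : s ≤ m), lowerFlip g ν k η X (charCov g ν Y s hs) =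
      lowerStraight g ν k η X (charCov g ν Y s hs) →
      lowerFlip g ν k η X Y = lowerStraight g ν k η X Y := by
    intro s
    induction s with
    | zero => exact fun _ h => h
    | succ s ih =>
      intro hs h
      refine ih (by omega) ?_
      rw [charCov, lowerFlip_shift hg hη hg0 hg1 hX (hY.charCov hg _ _),
        lowerStraight_shift hg hη hg0] at h
      set r : Fin m := ⟨m - 1 - s, by omega⟩
      have hne : content ν k - 1 - content ν r ≠ 0 := by
        have h2 : content ν k - 1 - content ν r = gap ν k r - 1 := by
          simp only [content, gap]; ring
        rw [h2, sub_ne_zero]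
        by_cases hr : r = k
        · rw [hr, gap_self]; exact zero_ne_one
        · exact hgap' r hr
      refine smul_right_injective V hne ?_
      dsimp only
      rw [eq_sub_of_add_eq h]
      module
  refine key m le_rfl ?_
  simp only [lowerFlip, lowerStraight, hη.charCov_univVec hg hY, map_zero, Finset.sum_const_zero]

/-- Lowering operators with the same index built from anticommuting covectors anticommute. -/
theorem IsHighest.lowered_anticomm (hg : IsGLAction g) (hη : IsHighest g ν η)
    (hgap : ∀ q, q ≠ k → gap ν k q ≠ 0) (hgap' : ∀ q, q ≠ k → gap ν k q ≠ 1)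
    (hX : IsCovector g X) (hY : IsCovector g Y)
    (hXY : ∀ p q v, X p (Y q v) = -Y q (X p v)) :
    lowered g (ν - Pi.single k 1) k (fun q => X q (lowered g ν k (fun p => Y p η) k)) k =
      -lowered g (ν - Pi.single k 1) k (fun q => Y q (lowered g ν k (fun p => X p η) k)) k := by
  -- The straight vector is the composite of X after Y. For anticommuting covectors the flipped one
  -- is minus the composite in the other order.
  have h := lowerFlip_eq_lowerStraight hg hη hgap hgap' hX hY
  rw [lowerFlip, lowerStraight] at h
  simp only [hY.lowered_eq, hX.lowered_eq, map_sum]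
  rw [← h, ← lowered_neg]
  simp only [hXY, Finset.sum_neg_distrib]

end Anticommutation

/-! ### Shift of the spectral parameter -/

section Umbral

open Polynomial

variable {M : Type*} [AddCommGroup M] [Module ℂ M]

/-- The linear map sending `x ^ r` to `a (r + 1)`. -/
noncomputable def umbral (a : ℕ → M) : ℂ[X] →ₗ[ℂ] M :=
  Polynomial.lsum fun r => LinearMap.toSpanSingleton ℂ M (a (r + 1))

@[simp] theorem umbral_monomial (a : ℕ → M) (r : ℕ) (c : ℂ) :
    umbral a (monomial r c) = c • a (r + 1) := by
  simp [umbral]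

/-- The sequence of coefficients of `a(u + c)`, where `a(u) = ∑ a_r u^{-r}`. -/
noncomputable def shiftSeq (c : ℂ) (a : ℕ → M) : ℕ → M
  | 0 => a 0
  | s + 1 => umbral a ((X - C c) ^ s)

/-- The umbral map sends 1/(u − x) to a(u) − a_0, hence 1/(u − (x − c)) to a(u + c) − a_0; so the
coefficients are images of powers of x − c, expanded here by the binomial formula. -/
theorem shiftSeq_succ_eq_sum (c : ℂ) (a : ℕ → M) (s : ℕ) :
    shiftSeq c a (s + 1) =
      ∑ r ∈ Finset.range (s + 1), ((s.choose r : ℂ) * (-c) ^ (s - r)) • a (r + 1) := by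
  have h : (X - C c) ^ s = ∑ r ∈ Finset.range (s + 1),
      monomial r ((s.choose r : ℂ) * (-c) ^ (s - r)) := by
    rw [sub_eq_add_neg, ← C_neg, add_pow]
    refine Finset.sum_congr rfl fun r _ => ?_
    rw [← C_mul_X_pow_eq_monomial, C_mul, C_pow, C_eq_natCast]
    ring
  rw [shiftSeq, h, map_sum]
  simp

theorem shiftSeq_one (c : ℂ) (a : ℕ → M) : shiftSeq c a 1 = a 1 := by
  rw [shiftSeq_succ_eq_sum]; simp

theorem umbral_shift (c : ℂ) (a : ℕ → M) (s : ℕ) :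
    shiftSeq c a (s + 2) = umbral a (X * (X - C c) ^ s) - c • umbral a ((X - C c) ^ s) := by
  rw [shiftSeq, pow_succ', sub_mul, map_sub, ← smul_eq_C_mul, map_smul]

theorem map_umbral {M' : Type*} [AddCommGroup M'] [Module ℂ M'] (φ : M →ₗ[ℂ] M') (a : ℕ → M)
    (p : ℂ[X]) : φ (umbral a p) = umbral (fun r => φ (a r)) p := by
  induction p using Polynomial.induction_on' with
  | add p q hp hq => simp [hp, hq]
  | monomial r c => simp

theorem map_shiftSeq {M' : Type*} [AddCommGroup M'] [Module ℂ M'] (φ : M →ₗ[ℂ] M') (c : ℂ)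
    (a : ℕ → M) (s : ℕ) : φ (shiftSeq c a s) = shiftSeq c (fun r => φ (a r)) s := by
  cases s with
  | zero => rfl
  | succ s => exact map_umbral φ a _

/-- The coefficient form of passing from (u − κ)a(u) = u·b̃(u), with b̃(u) = u⁻¹b(u), to the same
identity at u + c: the pole moves from κ to κ − c. -/
theorem shiftSeq_recursion (c κ : ℂ) (a b : ℕ → M) (h0 : a 0 = 0)
    (h : ∀ r, a (r + 1) = κ • a r + b r) (s : ℕ) :
    shiftSeq c a (s + 1) = (κ - c) • shiftSeq c a s + shiftSeq c b s := by
  cases s with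
  | zero => rw [shiftSeq_one, h, h0, shiftSeq, shiftSeq, h0, smul_zero, smul_zero]
  | succ s =>
    have key : ∀ p, umbral a (X * p) = κ • umbral a p + umbral b p := by
      intro p
      induction p using Polynomial.induction_on' with
      | add p q hp hq => rw [mul_add, map_add, hp, hq, map_add, map_add]; module
      | monomial r x =>
        rw [X_mul_monomial, umbral_monomial, umbral_monomial, umbral_monomial, h (r + 1)]
        module
    rw [umbral_shift, key, shiftSeq, shiftSeq]
    module

variable {A : Type*} [Ring A] [Algebra ℂ A] {n : ℕ}

/-- The defining relations of the Yangian are invariant under the shift of the spectral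
parameter. -/
theorem yangianDefect_shift (t : ℕ → Fin n → Fin n → A)
    (h0 : ∀ i j, t 0 i j = if i = j then 1 else 0)
    (ht : ∀ r s i j k l, yangianDefect t r s i j k l = 0) (c : ℂ) (r s : ℕ) (i j k l : Fin n) :
    yangianDefect (fun r i j => shiftSeq c (fun r => t r i j) r) r s i j k l = 0 := by
  set Φ : Fin n → Fin n → ℂ[X] →ₗ[ℂ] A := fun i j => umbral fun r => t r i j with hΦ
  have hΦm : ∀ i j r x, Φ i j (monomial r x) = x • t (r + 1) i j := fun i j r x =>
    umbral_monomial _ _ _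
  have h2 : ∀ i j s, shiftSeq c (fun r => t r i j) (s + 2) =
      Φ i j (X * (X - C c) ^ s) - c • Φ i j ((X - C c) ^ s) := fun i j s => umbral_shift _ _ _
  have h1 : ∀ i j s, shiftSeq c (fun r => t r i j) (s + 1) = Φ i j ((X - C c) ^ s) :=
    fun i j s => rfl
  have hone : ∀ i j, shiftSeq c (fun r => t r i j) 1 = t 1 i j := fun i j => shiftSeq_one _ _
  have hzero : ∀ i j, shiftSeq c (fun r => t r i j) 0 = t 0 i j := fun i j => rfl
  have hcomm : ∀ i j x, t 0 i j * x = x * t 0 i j := by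
    intro i j x; rw [h0]; split_ifs <;> simp
  -- The constant term t^{(0)} is not seen by the umbral map, so relations involving degree 0 are
  -- treated separately here and in `hright`.
  have hleft : ∀ p, t 1 i j * Φ k l p - Φ k l p * t 1 i j =
      t 0 k j * Φ i l p - Φ k j p * t 0 i l := by
    intro p
    induction p using Polynomial.induction_on' with
    | add p q hp hq =>
      simp only [map_add, mul_add, add_mul]
      rw [add_sub_add_comm, hp, hq]; abel
    | monomial r x =>
      have := ht 0 (r + 1) i j k l
      rw [yangianDefect, hcomm i j, sub_self, sub_zero, sub_eq_zero] at this
      simp only [hΦm, mul_smul_comm, smul_mul_assoc, ← smul_sub]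
      rw [this]
  have hright : ∀ p, -(Φ i j p * t 1 k l - t 1 k l * Φ i j p) =
      Φ k j p * t 0 i l - t 0 k j * Φ i l p := by
    intro p
    induction p using Polynomial.induction_on' with
    | add p q hp hq =>
      simp only [map_add, mul_add, add_mul]
      rw [add_sub_add_comm, neg_add, hp, hq]; abel
    | monomial r x =>
      have := ht (r + 1) 0 i j k l
      rw [yangianDefect, hcomm k l, sub_self, zero_sub, sub_eq_zero] at this
      simp only [hΦm, mul_smul_comm, smul_mul_assoc, ← smul_sub, ← smul_neg]
      rw [this]
  -- The remaining relations say that multiplication by x − y acts in a prescribed way on pairs of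
  -- polynomials. Replacing x, y by x − c, y − c changes nothing.
  have hmain : ∀ p q, (Φ i j (X * p) * Φ k l q - Φ k l q * Φ i j (X * p)) -
      (Φ i j p * Φ k l (X * q) - Φ k l (X * q) * Φ i j p) =
      Φ k j p * Φ i l q - Φ k j q * Φ i l p := by
    intro p q
    induction p using Polynomial.induction_on' with
    | add p p' hp hp' =>
      simp only [map_add, mul_add, add_mul] at hp hp' ⊢
      rw [add_sub_add_comm, add_sub_add_comm, add_sub_add_comm, hp, hp']; abel
    | monomial r x =>
      induction q using Polynomial.induction_on' with
      | add q q' hq hq' =>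
        simp only [map_add, mul_add, add_mul] at hq hq' ⊢
        rw [add_sub_add_comm, add_sub_add_comm, add_sub_add_comm, hq, hq']; abel
      | monomial s y =>
        have := sub_eq_zero.1 (ht (r + 1) (s + 1) i j k l)
        simp only [X_mul_monomial, hΦm, mul_smul_comm, smul_mul_assoc]
        simp only [smul_comm x y, ← smul_sub]
        rw [this]
  match r, s with
  | 0, 0 =>
    have := ht 0 0 i j k l
    simp only [yangianDefect, zero_add] at this ⊢
    simp only [hone, hzero, this]
  | 0, s + 1 =>
    simp only [yangianDefect, zero_add, hone]
    simp only [hzero, hcomm i j, sub_self, sub_zero, h1, hleft]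
  | r + 1, 0 =>
    simp only [yangianDefect, zero_add, hone]
    simp only [hzero, hcomm k l, sub_self, zero_sub, h1, hright]
  | r + 1, s + 1 =>
    simp only [yangianDefect, add_assoc, Nat.reduceAdd, h2]
    simp only [h1]
    rw [← hmain]
    simp only [sub_mul, mul_sub, mul_smul_comm, smul_mul_assoc]
    abel

end Umbral

/-! ### Yangian generators and one lowering operator -/

section Step

variable {m n : ℕ} {V : Type*} [AddCommGroup V] [Module ℂ V]
  {e : Fin m ⊕ Fin n → Fin m ⊕ Fin n → Module.End ℂ V}
  {ν : Fin m → ℂ} {k : Fin m} {η : V}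

/-- The action of `gl_m` contained in an action of `gl_{m|n}`. -/
def evenPart (e : Fin m ⊕ Fin n → Fin m ⊕ Fin n → Module.End ℂ V) (i j : Fin m) :
    Module.End ℂ V := e (inl i) (inl j)

/-- The normalized lowering operator `z_{ak}` on highest vectors of weight `ν`. -/
noncomputable def lowerOp (e : Fin m ⊕ Fin n → Fin m ⊕ Fin n → Module.End ℂ V) (ν : Fin m → ℂ)
    (k : Fin m) (a : Fin n) (η : V) : V :=
  lowered (evenPart e) ν k (fun p => e (inr a) (inl p) η) k

theorem IsGLSystem.isGLAction (he : IsGLSystem e) : IsGLAction (evenPart e) :=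
  fun i j k l => he.comm_even_even i j k l

theorem IsGLSystem.isCovector_rowRes (he : IsGLSystem e) (r : ℕ) (a : Fin n) :
    IsCovector (evenPart e) (rowRes e r a) := by
  intro i j p v
  have := congrArg (fun T => T v) (he.even_mul_rowRes i j r a p)
  simp only [Module.End.mul_apply, LinearMap.sub_apply] at this
  rw [evenPart, this]
  split_ifs <;> rfl

theorem IsGLSystem.isCovector_low (he : IsGLSystem e) (a : Fin n) :
    IsCovector (evenPart e) (fun p => e (inr a) (inl p)) := by
  have := he.isCovector_rowRes 0 a
  rwa [show rowRes e 0 a = fun p => e (inr a) (inl p) from funext fun p => rowRes_zero a p] at this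

theorem IsGLSystem.olsh_even (he : IsGLSystem e) (r : ℕ) (i j : Fin n) (p q : Fin m) (v : V) :
    olsh e r i j (evenPart e p q v) = evenPart e p q (olsh e r i j v) :=
  (congrArg (fun T => T v) (he.even_mul_olsh p q r i j)).symm

theorem IsHighest.olsh (he : IsGLSystem e) (hη : IsHighest (evenPart e) ν η) (r : ℕ)
    (i j : Fin n) : IsHighest (evenPart e) ν (olsh e r i j η) where
  raise p q hpq := by rw [← he.olsh_even, hη.raise p q hpq, map_zero]
  weight p := by rw [← he.olsh_even, hη.weight p, map_smul]

theorem IsHighest.smul {g : Fin m → Fin m → Module.End ℂ V} (hη : IsHighest g ν η) (c : ℂ) :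
    IsHighest g ν (c • η) where
  raise p q hpq := by rw [map_smul, hη.raise p q hpq, smul_zero]
  weight p := by rw [map_smul, hη.weight p, smul_comm]

theorem lowerOp_add (a : Fin n) (v w : V) :
    lowerOp e ν k a (v + w) = lowerOp e ν k a v + lowerOp e ν k a w := by
  simp only [lowerOp, map_add, lowered_add]

theorem lowerOp_smul (a : Fin n) (c : ℂ) (v : V) :
    lowerOp e ν k a (c • v) = c • lowerOp e ν k a v := by
  simp only [lowerOp, map_smul, lowered_smul]

/-- The lowering operator as a linear map. -/
noncomputable def lowerLin (e : Fin m ⊕ Fin n → Fin m ⊕ Fin n → Module.End ℂ V) (ν : Fin m → ℂ)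
    (k : Fin m) (a : Fin n) : Module.End ℂ V where
  toFun := lowerOp e ν k a
  map_add' := lowerOp_add a
  map_smul' c v := lowerOp_smul a c v

theorem lowerLin_apply (a : Fin n) (v : V) : lowerLin e ν k a v = lowerOp e ν k a v := rfl

theorem IsHighest.lowerLin (he : IsGLSystem e) (hη : IsHighest (evenPart e) ν η)
    (hgap : ∀ q, q ≠ k → gap ν k q ≠ 0) (a : Fin n) :
    IsHighest (evenPart e) (ν - Pi.single k 1) (lowerLin e ν k a η) :=
  (hη.isLowFamily (he.isCovector_low a)).isHighest_lowered he.isGLAction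
    fun q hq => hgap q hq.ne'

theorem IsHighest.lowerLin_anticomm (he : IsGLSystem e) (hη : IsHighest (evenPart e) ν η)
    (hgap : ∀ q, q ≠ k → gap ν k q ≠ 0) (hgap' : ∀ q, q ≠ k → gap ν k q ≠ 1) (a b : Fin n) :
    CovariantYangian.lowerLin e (ν - Pi.single k 1) k a (CovariantYangian.lowerLin e ν k b η) =
      -CovariantYangian.lowerLin e (ν - Pi.single k 1) k b
        (CovariantYangian.lowerLin e ν k a η) :=
  hη.lowered_anticomm he.isGLAction hgap hgap' (he.isCovector_low a) (he.isCovector_low b)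
    fun p q v => congrArg (fun T => T v) (he.anticomm_low_low a b p q)

/-- Each factor E on the right of the row contributes the content, by `lowered_shift_self`. -/
theorem IsHighest.lowered_rowRes (he : IsGLSystem e) (hη : IsHighest (evenPart e) ν η)
    (hgap : ∀ q, k < q → gap ν k q ≠ 0) (s : ℕ) (a : Fin n) :
    lowered (evenPart e) ν k (fun p => rowRes e s a p η) k =
      content ν k ^ s • CovariantYangian.lowerLin e ν k a η := by
  induction s with
  | zero => simp only [rowRes_zero, pow_zero, one_smul]; rfl
  | succ s ih =>
    have h := (hη.isLowFamily (he.isCovector_rowRes s a)).lowered_shift_self hgap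
    rw [ih, smul_smul, ← pow_succ'] at h
    rw [← h]
    congr 1
    funext p
    have h1 : ∀ q, evenPart e q p (rowRes e s a q η) =
        rowRes e s a q (evenPart e q p η) - rowRes e s a p η := by
      intro q
      rw [he.isCovector_rowRes s a, if_pos rfl]
    simp only [h1, rowRes_succ, LinearMap.sum_apply, Module.End.mul_apply, Finset.sum_sub_distrib,
      Finset.sum_const, Finset.card_univ, Fintype.card_fin, Nat.cast_smul_eq_nsmul]
    rw [add_sub_cancel]
    rfl

/-- The failure of the generators of the Yangian to commute with an operator. -/
noncomputable def defect (e : Fin m ⊕ Fin n → Fin m ⊕ Fin n → Module.End ℂ V) (Z : Module.End ℂ V)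
    (η : V) (i j : Fin n) (r : ℕ) : V :=
  olsh e r i j (Z η) - Z (olsh e r i j η)

theorem defect_zero (Z : Module.End ℂ V) (i j : Fin n) : defect e Z η i j 0 = 0 := by
  rw [defect, olsh_zero]; split_ifs <;> simp

/-- In series, with κ the content: T_ij(u) z_ak η − z_ak T_ij(u) η = (u − κ)⁻¹ z_ik T_aj(u) η. It is
`olsh_comm_low` after lowering, where R_i(u) becomes (u − κ)⁻¹ z_ik. -/
theorem IsHighest.defect_lowerLin (he : IsGLSystem e) (hη : IsHighest (evenPart e) ν η)
    (hgap : ∀ q, q ≠ k → gap ν k q ≠ 0) (a i j : Fin n) (r : ℕ) :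
    defect e (CovariantYangian.lowerLin e ν k a) η i j (r + 1) =
      content ν k • defect e (CovariantYangian.lowerLin e ν k a) η i j r +
        CovariantYangian.lowerLin e ν k i (CovariantYangian.olsh e r a j η) := by
  have hgap' : ∀ q, k < q → gap ν k q ≠ 0 := fun q hq => hgap q hq.ne'
  have key : ∀ r, defect e (CovariantYangian.lowerLin e ν k a) η i j r =
      ∑ s ∈ Finset.range r, content ν k ^ s •
        CovariantYangian.lowerLin e ν k i (CovariantYangian.olsh e (r - 1 - s) a j η) := by
    intro r
    have h1 : CovariantYangian.olsh e r i j (CovariantYangian.lowerLin e ν k a η) =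
        lowered (evenPart e) ν k (fun p => e (inr a) (inl p) (CovariantYangian.olsh e r i j η) +
          ∑ s ∈ Finset.range r, rowRes e s i p (CovariantYangian.olsh e (r - 1 - s) a j η)) k := by
      rw [lowerLin_apply, lowerOp, lowered_map _ (he.olsh_even r i j)]
      congr 1
      funext p
      have := congrArg (fun T => T η) (he.olsh_comm_low r i j a p)
      simpa only [Module.End.mul_apply, LinearMap.add_apply, LinearMap.sum_apply] using this
    rw [defect, h1, lowered_add]
    have h2 : ∀ (S : Finset ℕ) (f : ℕ → Fin m → V),
        lowered (evenPart e) ν k (fun p => ∑ s ∈ S, f s p) k =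
          ∑ s ∈ S, lowered (evenPart e) ν k (f s) k := by
      intro S f
      induction S using Finset.induction_on with
      | empty => simp [lowered_zero]
      | insert s S hs ih => simp only [Finset.sum_insert hs, lowered_add, ih]
    rw [h2]
    simp only [fun s => (hη.olsh he (r - 1 - s) a j).lowered_rowRes he hgap' s i]
    exact add_sub_cancel_left _ _
  rw [key, key, Finset.sum_range_succ', Finset.smul_sum]
  congr 1
  · refine Finset.sum_congr rfl fun s _ => ?_
    rw [smul_smul, ← pow_succ', show r + 1 - 1 - (s + 1) = r - 1 - s by omega]
  · simp

end Step

/-! ### Strings of lowering operators with equal index -/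

section Strings

variable {m n : ℕ} {V : Type*} [AddCommGroup V] [Module ℂ V]
  {e : Fin m ⊕ Fin n → Fin m ⊕ Fin n → Module.End ℂ V}
  {ν : Fin m → ℂ} {k : Fin m} {η : V}

/-- The composition `z_{a_1 k} ⋯ z_{a_d k}` of normalized lowering operators, applied to highest
vectors of weight `ν`. -/
noncomputable def lowerString (e : Fin m ⊕ Fin n → Fin m ⊕ Fin n → Module.End ℂ V)
    (ν : Fin m → ℂ) (k : Fin m) : List (Fin n) → Module.End ℂ V
  | [] => 1
  | a :: l => lowerLin e (ν - Pi.single k (l.length : ℂ)) k a * lowerString e ν k l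

/-- A weight from which one may lower `d` times along the index `k`. -/
def IsRegular (ν : Fin m → ℂ) (k : Fin m) (d : ℕ) : Prop :=
  ∀ q, q ≠ k → ∀ t : ℕ, t < d → gap ν k q ≠ t

theorem IsRegular.mono {d d' : ℕ} (h : IsRegular ν k d) (hd : d' ≤ d) : IsRegular ν k d' :=
  fun q hq t ht => h q hq t (ht.trans_le hd)

theorem gap_sub_natCast {q : Fin m} (hq : q ≠ k) (t : ℂ) :
    gap (ν - Pi.single k t) k q = gap ν k q - t := by
  simp [gap, hq]; ring

theorem content_sub_natCast (t : ℂ) : content (ν - Pi.single k t) k = content ν k - t := by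
  simp [content]; ring

theorem IsRegular.gap_ne {d : ℕ} (h : IsRegular ν k d) (t s : ℕ) (hts : t + s < d) (q : Fin m)
    (hq : q ≠ k) : gap (ν - Pi.single k (t : ℂ)) k q ≠ s := by
  rw [gap_sub_natCast hq, ne_eq, sub_eq_iff_eq_add]
  have := h q hq (s + t) (by omega)
  exact_mod_cast this

theorem weight_succ (t : ℕ) : ν - Pi.single k ((t + 1 : ℕ) : ℂ) =
    ν - Pi.single k (t : ℂ) - Pi.single k 1 := by
  rw [Nat.cast_succ, Pi.single_add, sub_sub]

theorem IsHighest.lowerString (he : IsGLSystem e) (hη : IsHighest (evenPart e) ν η)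
    (l : List (Fin n)) (hreg : IsRegular ν k l.length) :
    IsHighest (evenPart e) (ν - Pi.single k (l.length : ℂ)) (lowerString e ν k l η) := by
  induction l with
  | nil => simpa [CovariantYangian.lowerString] using hη
  | cons a l ih =>
    rw [List.length_cons, weight_succ]
    refine IsHighest.lowerLin he (ih (hreg.mono (by simp))) ?_ a
    intro q hq
    exact_mod_cast hreg.gap_ne l.length 0 (by simp) q hq

theorem lowerString_cons_apply (a : Fin n) (l : List (Fin n)) (v : V) :
    lowerString e ν k (a :: l) v =
      lowerLin e (ν - Pi.single k (l.length : ℂ)) k a (lowerString e ν k l v) := rfl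

theorem IsHighest.lowerString_cons_cons (he : IsGLSystem e) (hη : IsHighest (evenPart e) ν η)
    (a b : Fin n) (l : List (Fin n)) (hreg : IsRegular ν k (l.length + 2)) :
    CovariantYangian.lowerString e ν k (a :: b :: l) η =
      -CovariantYangian.lowerString e ν k (b :: a :: l) η := by
  simp only [lowerString_cons_apply, List.length_cons, weight_succ]
  refine (hη.lowerString he l (hreg.mono (by omega))).lowerLin_anticomm he ?_ ?_ a b
  · intro q hq
    exact_mod_cast hreg.gap_ne l.length 0 (by omega) q hq
  · intro q hq
    exact_mod_cast hreg.gap_ne l.length 1 (by omega) q hq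

/-- Exchange of the head with a later entry, built from adjacent anticommutations: the intermediate
letter is moved to the front and back, and these signs cancel. -/
theorem IsHighest.lowerString_swap (he : IsGLSystem e) (hη : IsHighest (evenPart e) ν η)
    (a i : Fin n) (l : List (Fin n)) (hreg : IsRegular ν k (l.length + 1)) (p : ℕ)
    (hp : p < l.length) :
    CovariantYangian.lowerString e ν k (i :: l.set p a) η =
      -CovariantYangian.lowerString e ν k (a :: l.set p i) η := by
  induction l generalizing p with
  | nil => simp at hp
  | cons b l ih =>
    cases p with
    | zero => exact hη.lowerString_cons_cons he i a l hreg
    | succ p =>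
      have hlen : ∀ c, (l.set p c).length = l.length := fun c => List.length_set
      have h := ih (hreg.mono (by simp)) p (by simpa using hp)
      rw [List.set_cons_succ, List.set_cons_succ,
        hη.lowerString_cons_cons he i b _ (by rw [hlen]; exact hreg),
        hη.lowerString_cons_cons he a b _ (by rw [hlen]; exact hreg),
        lowerString_cons_apply b (i :: _), h, lowerString_cons_apply b (a :: _), map_neg]
      simp only [List.length_cons, hlen]

theorem IsHighest.lowerString_eq_zero (he : IsGLSystem e) (hη : IsHighest (evenPart e) ν η)
    (l : List (Fin n)) (hreg : IsRegular ν k l.length) (hl : ¬l.Nodup) :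
    CovariantYangian.lowerString e ν k l η = 0 := by
  induction l with
  | nil => simp at hl
  | cons a l ih =>
    by_cases ha : a ∈ l
    · obtain ⟨p, hp, rfl⟩ := List.getElem_of_mem ha
      have h := hη.lowerString_swap he l[p] l[p] l hreg p hp
      rw [List.set_getElem_self] at h
      have h2 : (2 : ℂ) • CovariantYangian.lowerString e ν k (l[p] :: l) η = 0 := by
        rw [two_smul]; nth_rewrite 1 [h]; exact neg_add_cancel _
      exact (smul_eq_zero.1 h2).resolve_left two_ne_zero
    · rw [lowerString_cons_apply, ih (hreg.mono (by simp)) (fun h => hl (List.nodup_cons.2 ⟨ha, h⟩)),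
        map_zero]

/-- A priori every letter brings a pole of its own. By antisymmetry the poles of the inner letters
cancel, and only the one of the leftmost letter, at the content minus the length plus 1, remains. -/
theorem IsHighest.defect_lowerString (he : IsGLSystem e) (hη : IsHighest (evenPart e) ν η)
    (l : List (Fin n)) (hreg : IsRegular ν k l.length) (i j : Fin n) (r : ℕ) :
    defect e (CovariantYangian.lowerString e ν k l) η i j (r + 1) =
      (content ν k - l.length + 1) • defect e (CovariantYangian.lowerString e ν k l) η i j r +
        ∑ p : Fin l.length, CovariantYangian.lowerString e ν k (l.set p i)
          (CovariantYangian.olsh e r l[p] j η) := by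
  induction l generalizing i j r with
  | nil => simp [defect, CovariantYangian.lowerString]
  | cons a l ih =>
    have ih := ih (hreg.mono (by simp))
    set Z := CovariantYangian.lowerString e ν k l with hZ
    set z := fun b => CovariantYangian.lowerLin e (ν - Pi.single k (l.length : ℂ)) k b with hz
    have hc : CovariantYangian.lowerString e ν k (a :: l) = z a * Z := rfl
    have hsplit : ∀ b i j r, defect e (z b * Z) η i j r =
        defect e (z b) (Z η) i j r + z b (defect e Z η i j r) := by
      intro b i j r
      simp only [defect, Module.End.mul_apply, map_sub]
      abel
    have htop : ∀ i j r, defect e (z a) (Z η) i j (r + 1) =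
        (content ν k - l.length) • defect e (z a) (Z η) i j r +
          z i (CovariantYangian.olsh e r a j (Z η)) := fun i j r => by
      rw [← content_sub_natCast]
      exact IsHighest.defect_lowerLin he (hη.lowerString he l (hreg.mono (by simp)))
        (fun q hq => by exact_mod_cast hreg.gap_ne l.length 0 (by simp) q hq) a i j r
    have hlen : ∀ (p : ℕ) c, (l.set p c).length = l.length := fun p c => List.length_set
    have hcons : ∀ b (p : ℕ) c v, CovariantYangian.lowerString e ν k (b :: l.set p c) v =
        z b (CovariantYangian.lowerString e ν k (l.set p c) v) := by
      intro b p c v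
      rw [lowerString_cons_apply, hlen]
    -- The cancellation of poles: the defect of the inner string is a combination of strings with
    -- one letter replaced, and exchanging that letter with the outer one changes the sign.
    have hvanish : ∀ r, z a (defect e Z η i j r) + z i (defect e Z η a j r) = 0 := by
      intro r
      induction r with
      | zero => simp [defect_zero]
      | succ r ihr =>
        have hs : ∀ p : Fin l.length,
            z a (CovariantYangian.lowerString e ν k (l.set p i)
              (CovariantYangian.olsh e r l[p] j η)) =
            -z i (CovariantYangian.lowerString e ν k (l.set p a)
              (CovariantYangian.olsh e r l[p] j η)) := by
          intro p
          rw [← hcons, ← hcons]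
          exact (hη.olsh he r l[p] j).lowerString_swap he i a l hreg p p.2
        rw [ih, ih, map_add, map_add, map_smul, map_smul, map_sum, map_sum,
          Finset.sum_congr rfl fun p _ => hs p, Finset.sum_neg_distrib,
          eq_neg_of_add_eq_zero_left ihr]
        module
    have h0 : z i (CovariantYangian.olsh e r a j (Z η)) =
        z i (Z (CovariantYangian.olsh e r a j η)) + z i (defect e Z η a j r) := by
      rw [defect, map_sub]; abel
    have hsum : ∑ p : Fin (a :: l).length, CovariantYangian.lowerString e ν k ((a :: l).set p i)
          (CovariantYangian.olsh e r (a :: l)[p] j η) =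
        z i (Z (CovariantYangian.olsh e r a j η)) +
        ∑ p : Fin l.length, z a (CovariantYangian.lowerString e ν k (l.set p i)
          (CovariantYangian.olsh e r l[p] j η)) := by
      refine (Fin.sum_univ_succ (n := l.length) _).trans ?_
      congr 1
      refine Finset.sum_congr rfl fun p _ => ?_
      exact hcons a p i _
    rw [hc, hsplit, hsplit, htop, ih, map_add, map_smul, map_sum, hsum, h0,
      eq_neg_of_add_eq_zero_right (hvanish r), List.length_cons, Nat.cast_succ]
    module

/-- Highest vectors for the Yangian, with the eigenvalues of the generators. -/
structure IsYangianHighest (e : Fin m ⊕ Fin n → Fin m ⊕ Fin n → Module.End ℂ V)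
    (Λ : Fin n → ℕ → ℂ) (η : V) : Prop where
  raise : ∀ i j, i < j → ∀ r, olsh e r i j η = 0
  eigen : ∀ p r, olsh e r p p η = Λ p r • η

theorem IsYangianHighest.smul {e : Fin m ⊕ Fin n → Fin m ⊕ Fin n → Module.End ℂ V}
    {Λ : Fin n → ℕ → ℂ} (hΛ : IsYangianHighest e Λ η) (c : ℂ) : IsYangianHighest e Λ (c • η) where
  raise i j hij r := by rw [map_smul, hΛ.raise i j hij, smul_zero]
  eigen p r := by rw [map_smul, hΛ.eigen, smul_comm]

/-- In `hS` a letter b ≠ i contributes nothing: if b < j, then T_bj kills η; if b ≥ j ≥ i, then i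
already belongs to the downward closed list, so the altered string has a repeated letter. The
recursion for G is the coefficient form of division by u minus the pole. -/
theorem IsYangianHighest.lowerString (he : IsGLSystem e) (hη : IsHighest (evenPart e) ν η)
    {Λ : Fin n → ℕ → ℂ} (hΛ : IsYangianHighest e Λ η)
    (l : List (Fin n)) (hreg : IsRegular ν k l.length) (hnd : l.Nodup)
    (hl : ∀ b ∈ l, ∀ i ≤ b, i ∈ l) (G : Fin n → ℕ → ℂ) (hG0 : ∀ p, G p 0 = 0)
    (hG : ∀ p r, G p (r + 1) = (content ν k - l.length + 1) * G p r + Λ p r) :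
    IsYangianHighest e (fun p r => Λ p r + if p ∈ l then G p r else 0)
      (CovariantYangian.lowerString e ν k l η) := by
  have hS : ∀ i j, i ≤ j → ∀ r, ∑ p : Fin l.length,
      CovariantYangian.lowerString e ν k (l.set p i) (olsh e r l[p] j η) =
      (if i = j ∧ i ∈ l then Λ i r else 0) • CovariantYangian.lowerString e ν k l η := by
    intro i j hij r
    have hterm : ∀ p : Fin l.length, l[p] ≠ i →
        CovariantYangian.lowerString e ν k (l.set p i) (olsh e r l[p] j η) = 0 := by
      intro p hp
      rcases lt_or_ge l[p] j with hb | hb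
      · rw [hΛ.raise _ _ hb, map_zero]
      · obtain ⟨q, hq, hqi⟩ := List.getElem_of_mem (hl l[p] (List.getElem_mem _) i (hij.trans hb))
        have hqp : (p : ℕ) ≠ q := by
          rintro rfl
          exact hp hqi
        refine (hη.olsh he r l[p] j).lowerString_eq_zero he _ (by simpa using hreg) ?_
        intro hnd'
        have h1 : (l.set p i)[q]'(by simpa using hq) = i := by
          rw [List.getElem_set_of_ne hqp, hqi]
        have h2 : (l.set p i)[(p : ℕ)]'(by simp) = i := by simp
        exact hqp ((List.Nodup.getElem_inj_iff hnd').1 (h2.trans h1.symm))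
    by_cases hi : i ∈ l
    · obtain ⟨q, hq, rfl⟩ := List.getElem_of_mem hi
      rw [Finset.sum_eq_single ⟨q, hq⟩]
      · by_cases h : l[q] = j
        · subst h
          simp [hΛ.eigen]
        · have := hΛ.raise _ _ (lt_of_le_of_ne hij h) r
          simp [h, this]
      · intro p _ hp
        refine hterm p fun h => hp (Fin.ext ?_)
        exact (List.Nodup.getElem_inj_iff hnd).1 h
      · simp
    · rw [if_neg (fun h => hi h.2), zero_smul]
      refine Finset.sum_eq_zero fun p _ => hterm p ?_
      intro h
      exact hi (h ▸ List.getElem_mem _)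
  constructor
  · intro i j hij r
    have h : defect e (CovariantYangian.lowerString e ν k l) η i j r = 0 := by
      induction r with
      | zero => exact defect_zero _ _ _
      | succ r ih =>
        rw [hη.defect_lowerString he l hreg, ih, hS i j hij.le, if_neg (fun h => hij.ne h.1)]
        simp
    rw [defect, hΛ.raise i j hij, map_zero, sub_zero] at h
    exact h
  · intro p r
    have h : defect e (CovariantYangian.lowerString e ν k l) η p p r =
        (if p ∈ l then G p r else 0) • CovariantYangian.lowerString e ν k l η := by
      induction r with
      | zero => rw [defect_zero, hG0]; simp
      | succ r ih =>
        rw [hη.defect_lowerString he l hreg, ih, hS p p le_rfl, hG]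
        by_cases hp : p ∈ l
        · simp only [hp, if_true, and_self]; module
        · simp [hp]
    rw [defect, sub_eq_iff_eq_add, hΛ.eigen, map_smul] at h
    rw [h, add_smul, add_comm]

end Strings

/-! ### Passage to modules over the enveloping algebra -/

section Modules

variable (m n : ℕ) (V : Type*) [AddCommGroup V] [Module ℂ V] [Module (UGL m n) V]
  [IsScalarTower ℂ (UGL m n) V]

/-- The representation of `U(gl_{m|n})` on a module. -/
noncomputable def act : UGL m n →ₐ[ℂ] Module.End ℂ V := Algebra.lsmul ℂ ℂ V

/-- The operators of the generators `E_ij`. -/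
noncomputable def actE (i j : Fin m ⊕ Fin n) : Module.End ℂ V := act m n V (E i j)

variable {m n V}

theorem act_apply (x : UGL m n) (v : V) : act m n V x v = x • v := rfl

theorem actE_apply (i j : Fin m ⊕ Fin n) (v : V) : actE m n V i j v = (E i j : UGL m n) • v := rfl

theorem actE_isGLSystem : IsGLSystem (actE m n V) := by
  intro i j k l
  have h := congrArg (act m n V) (RingQuot.mkAlgHom_rel ℂ (GLRel.comm i j k l))
  rw [← AlgHom.comp_apply, ← AlgHom.comp_apply] at h
  set φ := (act m n V).comp (RingQuot.mkAlgHom ℂ (GLRel m n)) with hφ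
  have hι : ∀ i j, φ (FreeAlgebra.ι ℂ (i, j)) = actE m n V i j := fun i j => rfl
  simp only [map_sub, map_mul, map_smul, hι] at h
  rw [h]
  congr 1 <;> split_ifs <;> simp [hι]

theorem act_olshanski (r : ℕ) (i j : Fin n) :
    act m n V (olshanski m r i j) = olsh (actE m n V) r i j := by
  match r with
  | 0 => simp only [olshanski, olsh_zero]; split_ifs <;> simp
  | 1 => rfl
  | r + 2 =>
    have hpow : ∀ k l, act m n V
        (((Matrix.of fun p q : Fin m => (E (inl p) (inl q) : UGL m n)) ^ r) k l) =
        (evenMatrix (actE m n V) ^ r) k l := by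
      intro k l
      have := map_pow (act m n V).mapMatrix
        (Matrix.of fun p q : Fin m => (E (inl p) (inl q) : UGL m n)) r
      exact congrFun (congrFun this k) l
    simp only [olshanski, map_sum, map_mul, hpow, olsh, rowRes, Finset.sum_mul]
    rw [Finset.sum_comm]
    rfl

theorem act_shiftedOlshanski (r : ℕ) (i j : Fin n) :
    act m n V (shiftedOlshanski m r i j) =
      shiftSeq (m : ℂ) (fun r => olsh (actE m n V) r i j) r := by
  cases r with
  | zero => exact act_olshanski 0 i j
  | succ s =>
    simp only [shiftSeq_succ_eq_sum, shiftedOlshanski, map_sum, map_smul, act_olshanski]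

/-! ### The lowering operators on highest vectors -/

variable {ν : Fin m → ℂ} {k : Fin m} {η : V}

theorem chain_smul (a : Fin n) (p : Fin m) (l : List (Fin m)) (v : V) :
    (chain a p l : UGL m n) • v =
      pathVec (evenPart (actE m n V)) (fun q => actE m n V (inr a) (inl q) v) p l := by
  induction l generalizing p with
  | nil => rfl
  | cons q l ih => rw [chain, mul_smul, ih, pathVec]; rfl

theorem IsHighest.h_sub_h_smul (hη : IsHighest (evenPart (actE m n V)) ν η) (i j : Fin m) :
    (h n i - h n j : UGL m n) • η = gap ν i j • η := by
  have hw : ∀ i, (h n i : UGL m n) • η = (ν i - (i : ℕ)) • η := by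
    intro i
    rw [h, sub_smul, algebraMap_smul, sub_smul]
    congr 1
    exact hη.weight i
  rw [sub_smul, hw, hw, gap, sub_smul (ν i - _)]

theorem IsHighest.h_prod_smul (hη : IsHighest (evenPart (actE m n V)) ν η) (i : Fin m)
    (l : List (Fin m)) :
    ((l.map (fun j => h n i - h n j)).prod : UGL m n) • η = (l.map (gap ν i)).prod • η := by
  induction l with
  | nil => simp
  | cons j l ih =>
    rw [List.map_cons, List.prod_cons, mul_smul, ih, smul_algebra_smul_comm, hη.h_sub_h_smul,
      List.map_cons, List.prod_cons, smul_smul, mul_comm]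

/-- On weight vectors the factors h_k − h_j become gaps; z_ak is the normalized operator with its
denominators cleared. -/
theorem IsHighest.zLower_smul (hη : IsHighest (evenPart (actE m n V)) ν η)
    (hgap : ∀ q, q ≠ k → gap ν k q ≠ 0) (a : Fin n) :
    (zLower a k : UGL m n) • η =
      (∏ q ∈ Finset.Ioi k, gap ν k q) • CovariantYangian.lowerLin (actE m n V) ν k a η := by
  rw [zLower, Finset.sum_smul, lowerLin_apply, lowerOp, lowered, Finset.smul_sum]
  refine Finset.sum_congr rfl fun S hS => ?_
  have hS := Finset.mem_powerset.1 hS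
  have hprod : (((Finset.Ioi k \ S).sort (· ≤ ·)).map (gap ν k)).prod =
      ∏ q ∈ Finset.Ioi k \ S, gap ν k q := by
    rw [← List.prod_toFinset _ (Finset.sort_nodup _ _), Finset.sort_toFinset]
  rw [mul_smul, hη.h_prod_smul, smul_algebra_smul_comm, chain_smul, hprod, smul_smul,
    ← Finset.prod_sdiff hS, mul_assoc, ← Finset.prod_mul_distrib]
  rw [Finset.prod_congr rfl fun q hq => mul_inv_cancel₀
    (hgap q (Finset.mem_Ioi.1 (hS hq)).ne'), Finset.prod_const_one, mul_one]

theorem IsHighest.zLower_prod_smul (hη : IsHighest (evenPart (actE m n V)) ν η)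
    (l : List (Fin n)) (hreg : IsRegular ν k l.length) :
    ∃ c : ℂ, ((l.map fun a => zLower a k).prod : UGL m n) • η =
      c • CovariantYangian.lowerString (actE m n V) ν k l η := by
  induction l with
  | nil => exact ⟨1, by simp [CovariantYangian.lowerString]⟩
  | cons a l ih =>
    have hreg' : IsRegular ν k l.length := hreg.mono (by simp)
    obtain ⟨c, hc⟩ := ih hreg'
    refine ⟨c * ∏ q ∈ Finset.Ioi k, gap (ν - Pi.single k (l.length : ℂ)) k q, ?_⟩
    rw [List.map_cons, List.prod_cons, mul_smul, hc, smul_algebra_smul_comm,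
      (hη.lowerString actE_isGLSystem l hreg').zLower_smul (k := k) (fun q hq => by
        exact_mod_cast hreg.gap_ne l.length 0 (by simp) q hq), smul_smul, lowerString_cons_apply]

end Modules

/-! ### Eigenvalues as power series in u⁻¹ -/

section Series

open PowerSeries (X C coeff)

/-- The geometric series `∑ c^r x^r`. -/
noncomputable def geom (c : ℂ) : PowerSeries ℂ := PowerSeries.mk fun r => c ^ r

theorem geom_eq (c : ℂ) : geom c = 1 + C c * (X * geom c) := by
  ext r
  cases r with
  | zero => simp [geom]
  | succ r => simp [geom, PowerSeries.coeff_succ_X_mul, PowerSeries.coeff_one, pow_succ']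

/-- The contribution of one string of lowering operators to the eigenvalues. -/
noncomputable def stringFactor (c : ℂ) : PowerSeries ℂ := 1 + X * geom c

/-- With X = u⁻¹ the factor is 1 + 1/(u − c), and the recursion says that g is the coefficient
sequence of f/(u − c). -/
theorem coeff_mul_stringFactor (f : PowerSeries ℂ) (c : ℂ) (g : ℕ → ℂ) (h0 : g 0 = 0)
    (hg : ∀ r, g (r + 1) = c * g r + coeff r f) (r : ℕ) :
    coeff r (f * stringFactor c) = coeff r f + g r := by
  have hf : f * stringFactor c = f + X * (f * geom c) := by rw [stringFactor]; ring
  have key : ∀ r, coeff r (X * (f * geom c)) = g r := by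
    intro r
    induction r with
    | zero => simp [h0]
    | succ r ih =>
      have h1 : f * geom c = f + C c * (X * (f * geom c)) := by
        conv_lhs => rw [geom_eq]
        ring
      rw [PowerSeries.coeff_succ_X_mul, h1, map_add, PowerSeries.coeff_C_mul, ih, hg, add_comm]
  rw [hf, map_add, key]

theorem u_mul_X : u * ((X : PowerSeries ℂ) : LaurentSeries ℂ) = 1 := by
  rw [HahnSeries.ofPowerSeries_X, u, HahnSeries.single_mul_single]
  simp

theorem u_sub_mul_geom (c : ℂ) :
    (u - HahnSeries.C c) * ((X * geom c : PowerSeries ℂ) : LaurentSeries ℂ) = 1 := by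
  have h := congrArg (HahnSeries.ofPowerSeries ℤ ℂ) (geom_eq c)
  rw [map_add, map_mul, map_one, HahnSeries.ofPowerSeries_C] at h
  rw [sub_mul, map_mul, ← mul_assoc, u_mul_X, one_mul, ← map_mul, sub_eq_iff_eq_add, h]

theorem coe_one_add_mul_geom (c x : ℂ) :
    ((1 + C x * (X * geom c) : PowerSeries ℂ) : LaurentSeries ℂ) =
      (u - HahnSeries.C c + HahnSeries.C x) / (u - HahnSeries.C c) := by
  have h := u_sub_mul_geom c
  rw [eq_div_iff (left_ne_zero_of_mul_eq_one h), map_add, map_mul, map_one,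
    HahnSeries.ofPowerSeries_C]
  linear_combination (HahnSeries.C x : LaurentSeries ℂ) * h

/-- The eigenvalue series after the strings of lowering operators with index at least `s`. -/
noncomputable def eigenSeries {m n : ℕ} (lam : Fin m ⊕ Fin n → ℕ) (mu : Fin m → ℕ) (s : ℕ)
    (p : Fin n) : PowerSeries ℂ :=
  (1 + C (lam (inr p) : ℂ) * (X * geom (-(m : ℂ)))) *
    ∏ i : Fin m, if s ≤ i ∧ (p : ℕ) + 1 + mu i ≤ lam (inl i) then
      stringFactor ((mu i : ℂ) - (i : ℕ)) else 1

theorem eigenSeries_step {m n : ℕ} (lam : Fin m ⊕ Fin n → ℕ) (mu : Fin m → ℕ) (k : Fin m)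
    (p : Fin n) : eigenSeries lam mu k p = eigenSeries lam mu (k + 1) p *
      if (p : ℕ) + mu k < lam (inl k) then stringFactor ((mu k : ℂ) - (k : ℕ)) else 1 := by
  rw [eigenSeries, eigenSeries, mul_assoc]
  congr 1
  have : (if (p : ℕ) + mu k < lam (inl k) then stringFactor ((mu k : ℂ) - (k : ℕ)) else 1) =
      ∏ i : Fin m, if i = k then (if (p : ℕ) + mu i < lam (inl i) then
        stringFactor ((mu i : ℂ) - (i : ℕ)) else 1) else 1 := by simp
  rw [this, ← Finset.prod_mul_distrib]
  refine Finset.prod_congr rfl fun i _ => ?_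
  by_cases hik : i = k
  · subst hik
    by_cases hc : (p : ℕ) + mu i < lam (inl i)
    · simp [hc, show (p : ℕ) + 1 + mu i ≤ lam (inl i) by omega]
    · simp [hc, show ¬(p : ℕ) + 1 + mu i ≤ lam (inl i) by omega]
  · have h1 : (i : ℕ) ≠ k := fun h => hik (Fin.ext h)
    have h2 : (k : ℕ) ≤ i ↔ (k : ℕ) + 1 ≤ i := by omega
    simp only [hik, if_false, mul_one, h2]

theorem eigenSeries_zero_coe {m n : ℕ} (lam : Fin m ⊕ Fin n → ℕ) (mu : Fin m → ℕ) (p : Fin n) :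
    ((eigenSeries lam mu 0 p : PowerSeries ℂ) : LaurentSeries ℂ) = highestWeight lam mu p := by
  have hfac : ∀ i : Fin m, ((stringFactor ((mu i : ℂ) - (i : ℕ)) : PowerSeries ℂ) :
      LaurentSeries ℂ) = (u - (mu i : LaurentSeries ℂ) + (((i : ℕ) : LaurentSeries ℂ) + 1)) /
        (u - (mu i : LaurentSeries ℂ) + (((i : ℕ) : LaurentSeries ℂ) + 1) - 1) := by
    intro i
    have := coe_one_add_mul_geom ((mu i : ℂ) - (i : ℕ)) 1
    rw [map_one, one_mul] at this
    rw [stringFactor, this, map_sub, map_natCast, map_natCast, map_one]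
    congr 1 <;> ring
  rw [eigenSeries, map_mul, coe_one_add_mul_geom, map_prod, highestWeight]
  congr 1
  · rw [map_neg, map_natCast, map_natCast, sub_neg_eq_add]
    congr 1
    ring
  · rw [Finset.prod_filter]
    refine Finset.prod_congr rfl fun i _ => ?_
    simp only [Nat.zero_le, true_and]
    split_ifs
    · exact hfac i
    · exact map_one _

end Series

/-! ### The vector ζ_μ and the Yangian action on the multiplicity space -/

section Main

variable {m n : ℕ} {V : Type*} [AddCommGroup V] [Module ℂ V] [Module (UGL m n) V]
  [IsScalarTower ℂ (UGL m n) V]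

open PowerSeries (X C coeff)

theorem shiftSeq_add {M : Type*} [AddCommGroup M] [Module ℂ M] (c : ℂ) (a b : ℕ → M) (s : ℕ) :
    shiftSeq c (fun r => a r + b r) s = shiftSeq c a s + shiftSeq c b s := by
  cases s with
  | zero => rfl
  | succ s => simp only [shiftSeq_succ_eq_sum, smul_add, Finset.sum_add_distrib]

/-- The eigenvalues of the unshifted generators on the highest vector. -/
def initialEigen (lam : Fin m ⊕ Fin n → ℕ) (p : Fin n) : ℕ → ℂ
  | 0 => 1
  | 1 => lam (inr p)
  | _ + 2 => 0

/-- In degree at least 2 the rightmost factor E_{p,m+j} is a raising operator and kills ζ, so only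
the `gl_n` part contributes. -/
theorem IsHighestVector.isYangianHighest {lam : Fin m ⊕ Fin n → ℕ} {ζ : V}
    (hζ : IsHighestVector (m := m) (n := n) (fun i => (lam i : ℂ)) ζ) :
    IsYangianHighest (actE m n V) (initialEigen lam) ζ where
  raise i j hij r := by
    match r with
    | 0 => simp [hij.ne]
    | 1 => exact hζ.2.1 _ _ (Sum.Lex.inr hij)
    | r + 2 =>
      rw [olsh_eq_row, LinearMap.sum_apply]
      refine Finset.sum_eq_zero fun p _ => ?_
      rw [Module.End.mul_apply, actE_apply, hζ.2.1 _ _ (Sum.Lex.sep _ _), map_zero]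
  eigen p r := by
    match r with
    | 0 => simp [initialEigen]
    | 1 => exact hζ.2.2 _
    | r + 2 =>
      rw [olsh_eq_row, LinearMap.sum_apply, initialEigen, zero_smul]
      refine Finset.sum_eq_zero fun p _ => ?_
      rw [Module.End.mul_apply, actE_apply, hζ.2.1 _ _ (Sum.Lex.sep _ _), map_zero]

theorem shiftSeq_initialEigen (lam : Fin m ⊕ Fin n → ℕ) (mu : Fin m → ℕ) (p : Fin n) (r : ℕ) :
    shiftSeq (m : ℂ) (initialEigen lam p) r = coeff r (eigenSeries lam mu m p) := by
  have h1 : eigenSeries lam mu m p = 1 + C (lam (inr p) : ℂ) * (X * geom (-(m : ℂ))) := by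
    rw [eigenSeries, Finset.prod_eq_one, mul_one]
    intro i _
    rw [if_neg]
    have := i.2
    omega
  rw [h1]
  cases r with
  | zero => simp [shiftSeq, initialEigen]
  | succ s =>
    rw [shiftSeq_succ_eq_sum, Finset.sum_eq_single 0]
    · rw [map_add, PowerSeries.coeff_C_mul, PowerSeries.coeff_succ_X_mul]
      simp [initialEigen, PowerSeries.coeff_one, geom, mul_comm]
    · intro b _ hb
      obtain ⟨b, rfl⟩ := Nat.exists_eq_succ_of_ne_zero hb
      simp [initialEigen]
    · simp

/-- The indices of the `k`-th string of lowering operators. -/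
def stringList (lam : Fin m ⊕ Fin n → ℕ) (mu : Fin m → ℕ) (k : Fin m) : List (Fin n) :=
  ((List.finRange n).filter (fun a : Fin n => (a : ℕ) + mu k < lam (inl k))).reverse

theorem mem_stringList {lam : Fin m ⊕ Fin n → ℕ} {mu : Fin m → ℕ} {k : Fin m} {a : Fin n} :
    a ∈ stringList lam mu k ↔ (a : ℕ) + mu k < lam (inl k) := by
  simp [stringList]

theorem nodup_stringList (lam : Fin m ⊕ Fin n → ℕ) (mu : Fin m → ℕ) (k : Fin m) :
    (stringList lam mu k).Nodup :=
  List.nodup_reverse.2 ((List.nodup_finRange n).filter _)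

theorem length_stringList {lam : Fin m ⊕ Fin n → ℕ} {mu : Fin m → ℕ} {k : Fin m}
    (hle : mu k ≤ lam (inl k)) (hge : lam (inl k) ≤ mu k + n) :
    (stringList lam mu k).length + mu k = lam (inl k) := by
  have h1 : (stringList lam mu k).toFinset.map Fin.valEmbedding =
      Finset.range (lam (inl k) - mu k) := by
    ext a
    simp only [Finset.mem_map, List.mem_toFinset, mem_stringList, Fin.valEmbedding_apply,
      Finset.mem_range]
    constructor
    · rintro ⟨a, ha, rfl⟩; omega
    · intro ha
      exact ⟨⟨a, by omega⟩, by simp only; omega, rfl⟩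
  have h2 := congrArg Finset.card h1
  rw [Finset.card_map, List.toFinset_card_of_nodup (nodup_stringList lam mu k),
    Finset.card_range] at h2
  omega

/-- The weight after the strings of lowering operators with index at least `s`. -/
def stageWeight (lam : Fin m ⊕ Fin n → ℕ) (mu : Fin m → ℕ) (s : ℕ) (i : Fin m) : ℕ :=
  if (i : ℕ) < s then lam (inl i) else mu i

/-- For q < k the gap is negative, since both entries are still those of λ. For q > k it is at least
λ_k − μ_k + (q − k), as μ_q ≤ μ_k, and so exceeds the length of the string. -/
theorem stageWeight_isRegular {lam : Fin m ⊕ Fin n → ℕ} {mu : Fin m → ℕ}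
    (hlam : Antitone fun i : Fin m => lam (inl i)) (hmu : Antitone mu)
    (hle : ∀ i : Fin m, mu i ≤ lam (inl i)) (hge : ∀ i : Fin m, lam (inl i) ≤ mu i + n)
    (k : Fin m) :
    IsRegular (fun i => (stageWeight lam mu (k + 1) i : ℂ)) k (stringList lam mu k).length := by
  intro q hq t ht h
  have hlen := length_stringList (hle k) (hge k)
  have h' : ((stageWeight lam mu (k + 1) k : ℤ) - (k : ℕ)) -
      ((stageWeight lam mu (k + 1) q : ℤ) - (q : ℕ)) = t := by
    rw [gap] at h
    exact_mod_cast h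
  rw [stageWeight, if_pos (Nat.lt_succ_self _), stageWeight] at h'
  rcases lt_or_gt_of_ne hq with hqk | hqk
  · have h1 : lam (inl k) ≤ lam (inl q) := hlam hqk.le
    have h2 : (q : ℕ) < k := hqk
    rw [if_pos (by omega)] at h'
    omega
  · have h1 : mu q ≤ mu k := hmu hqk.le
    have h2 : (k : ℕ) < q := hqk
    rw [if_neg (by omega)] at h'
    omega

theorem loweringProduct_isHighest {lam : Fin m ⊕ Fin n → ℕ} {mu : Fin m → ℕ} {ζ : V}
    (hlam : Antitone fun i : Fin m => lam (inl i)) (hmu : Antitone mu)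
    (hζ : IsHighestVector (m := m) (n := n) (fun i => (lam i : ℂ)) ζ)
    (hle : ∀ i : Fin m, mu i ≤ lam (inl i)) (hge : ∀ i : Fin m, lam (inl i) ≤ mu i + n) :
    IsHighest (evenPart (actE m n V)) (fun i => (mu i : ℂ))
        ((loweringProduct lam mu : UGL m n) • ζ) ∧
      ∃ Λ : Fin n → ℕ → ℂ,
        IsYangianHighest (actE m n V) Λ ((loweringProduct lam mu : UGL m n) • ζ) ∧
        ∀ p r, shiftSeq (m : ℂ) (Λ p) r = coeff r (eigenSeries lam mu 0 p) := by
  set L : List (UGL m n) := List.ofFn fun j : Fin m =>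
    ((stringList lam mu j).map fun a => zLower a j).prod with hL
  have hlenL : L.length = m := List.length_ofFn
  have key : ∀ s ≤ m,
      IsHighest (evenPart (actE m n V)) (fun i => (stageWeight lam mu s i : ℂ))
        ((L.drop s).prod • ζ) ∧
      ∃ Λ : Fin n → ℕ → ℂ, IsYangianHighest (actE m n V) Λ ((L.drop s).prod • ζ) ∧
        ∀ p r, shiftSeq (m : ℂ) (Λ p) r = coeff r (eigenSeries lam mu s p) := by
    intro s hs
    -- The product acts from the right, so the string of the largest index comes first and the
    -- induction descends.
    induction hs using Nat.decreasingInduction with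
    | self =>
      rw [List.drop_of_length_le hlenL.le, List.prod_nil, one_smul]
      refine ⟨⟨fun i j hij => hζ.2.1 _ _ (Sum.Lex.inl hij), fun i => ?_⟩, _,
        hζ.isYangianHighest, shiftSeq_initialEigen lam mu⟩
      rw [stageWeight, if_pos i.2]
      exact hζ.2.2 _
    | of_succ s hs ih =>
      obtain ⟨hη, Λ, hΛ, hser⟩ := ih
      set k : Fin m := ⟨s, hs⟩ with hk
      set ν : Fin m → ℂ := fun i => (stageWeight lam mu (s + 1) i : ℂ) with hν
      set l := stringList lam mu k with hl
      have hreg : IsRegular ν k l.length := stageWeight_isRegular hlam hmu hle hge k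
      have hlen : l.length + mu k = lam (inl k) := length_stringList (hle k) (hge k)
      have hdrop : L.drop s = (l.map fun a => zLower a k).prod :: L.drop (s + 1) := by
        rw [List.drop_eq_getElem_cons (by omega)]
        simp [hL, hl, hk]
      obtain ⟨c, hc⟩ := hη.zLower_prod_smul l hreg
      rw [hdrop, List.prod_cons, mul_smul, hc]
      have hνk : ν k = lam (inl k) := by simp [hν, stageWeight, hk]
      -- The pole left by the string; the shift by m removes the summand m and leaves the parameter
      -- of `stringFactor`.
      have hκ : content ν k - l.length + 1 = (m : ℂ) + ((mu k : ℂ) - (k : ℕ)) := by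
        rw [content, hνk, ← hlen]
        push_cast
        ring
      constructor
      · have hw : (fun i => (stageWeight lam mu s i : ℂ)) = ν - Pi.single k (l.length : ℂ) := by
          funext i
          by_cases hi : i = k
          · subst hi
            rw [Pi.sub_apply, Pi.single_eq_same, hνk, ← hlen, stageWeight, if_neg (lt_irrefl s)]
            push_cast
            ring
          · have h1 : (i : ℕ) ≠ s := fun h => hi (Fin.ext h)
            have h2 : (i : ℕ) < s ↔ (i : ℕ) < s + 1 := by omega
            simp only [Pi.sub_apply, Pi.single_eq_of_ne hi, sub_zero, hν, stageWeight, h2]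
        rw [hw]
        exact (hη.lowerString actE_isGLSystem l hreg).smul c
      · let G : Fin n → ℕ → ℂ := fun p r =>
          Nat.rec 0 (fun r x => (content ν k - l.length + 1) * x + Λ p r) r
        have hG0 : ∀ p, G p 0 = 0 := fun p => rfl
        have hG : ∀ p r, G p (r + 1) = (content ν k - l.length + 1) * G p r + Λ p r :=
          fun p r => rfl
        refine ⟨_, (hΛ.lowerString actE_isGLSystem hη l hreg (nodup_stringList lam mu k)
          (fun b hb i hi => mem_stringList.2 ?_) G hG0 hG).smul c, ?_⟩
        · have := mem_stringList.1 hb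
          have hi : (i : ℕ) ≤ b := hi
          omega
        · intro p r
          have hstep := eigenSeries_step lam mu k p
          rw [show eigenSeries lam mu s p = eigenSeries lam mu k p from rfl, hstep]
          by_cases hp : p ∈ l
          · have hp' := mem_stringList.1 hp
            simp only [hp, if_true, hp']
            rw [shiftSeq_add, hser]
            symm
            refine coeff_mul_stringFactor _ _ (shiftSeq (m : ℂ) (G p)) (hG0 p) (fun r => ?_) r
            rw [shiftSeq_recursion (m : ℂ) (content ν k - l.length + 1) (G p) (Λ p) (hG0 p)
              (hG p), hser, hκ, add_sub_cancel_left, smul_eq_mul]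
          · have hp' : ¬(p : ℕ) + mu k < lam (inl k) := fun h => hp (mem_stringList.2 h)
            simp only [hp, if_false, hp', add_zero, mul_one]
            exact hser p r
  have h0 := key 0 (Nat.zero_le _)
  have hw : (fun i => (stageWeight lam mu 0 i : ℂ)) = fun i => (mu i : ℂ) := by
    funext i; simp [stageWeight]
  rwa [hw] at h0

/-- The operators of the shifted Olshanski homomorphism on a multiplicity space. -/
noncomputable def yangianOp (V : Type*) [AddCommGroup V] [Module ℂ V] [Module (UGL m n) V]
    [IsScalarTower ℂ (UGL m n) V] (mu : Fin m → ℂ) (r : ℕ) (i j : Fin n) :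
    Module.End ℂ (multiplicitySpace n V mu) :=
  (act m n V (shiftedOlshanski m r i j)).restrict (by
    have hcomm : ∀ p q v, act m n V (shiftedOlshanski m r i j) (actE m n V (inl p) (inl q) v) =
        actE m n V (inl p) (inl q) (act m n V (shiftedOlshanski m r i j) v) := by
      intro p q v
      rw [act_shiftedOlshanski]
      have h : ∀ r, Commute (olsh (actE m n V) r i j) (actE m n V (inl p) (inl q)) := fun r =>
        (actE_isGLSystem.even_mul_olsh p q r i j).symm
      have : Commute (shiftSeq (m : ℂ) (fun r => olsh (actE m n V) r i j) r)
          (actE m n V (inl p) (inl q)) := by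
        cases r with
        | zero => exact h 0
        | succ s =>
          rw [shiftSeq_succ_eq_sum]
          exact Commute.sum_left _ _ _ fun r _ => (h _).smul_left _
      exact congrArg (fun T => T v) this.eq
    rintro v ⟨h1, h2⟩
    refine ⟨fun p q hpq => ?_, fun p => ?_⟩
    · rw [← actE_apply, ← hcomm, actE_apply, h1 p q hpq, map_zero]
    · rw [← actE_apply, ← hcomm, actE_apply, h2 p, map_smul])

theorem coe_yangianOp (mu : Fin m → ℂ) (r : ℕ) (i j : Fin n) (η : multiplicitySpace n V mu) :
    (yangianOp V mu r i j η : V) =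
      shiftSeq (m : ℂ) (fun r => olsh (actE m n V) r i j) r (η : V) := by
  rw [← act_shiftedOlshanski]; rfl

theorem yangianOp_zero (mu : Fin m → ℂ) (i j : Fin n) :
    yangianOp V mu 0 i j = if i = j then 1 else 0 := by
  refine LinearMap.ext fun η => Subtype.ext ?_
  rw [coe_yangianOp]
  simp only [shiftSeq, olsh_zero]
  split_ifs <;> rfl

theorem yangianOp_relation (mu : Fin m → ℂ) (r s : ℕ) (i j k l : Fin n) :
    yangianDefect (yangianOp V mu) r s i j k l = 0 := by
  refine LinearMap.ext fun η => Subtype.ext ?_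
  have h := congrArg (fun T => T (η : V)) (yangianDefect_shift (olsh (actE m n V))
    (fun i j => olsh_zero i j) actE_isGLSystem.yangian (m : ℂ) r s i j k l)
  simp only [yangianDefect, LinearMap.sub_apply, Module.End.mul_apply, AddSubgroupClass.coe_sub,
    coe_yangianOp] at h ⊢
  exact h

/-- The representation of the Yangian on a multiplicity space. -/
noncomputable def yangianRep (V : Type*) [AddCommGroup V] [Module ℂ V] [Module (UGL m n) V]
    [IsScalarTower ℂ (UGL m n) V] (mu : Fin m → ℂ) :
    Yangian n →ₐ[ℂ] Module.End ℂ (multiplicitySpace n V mu) :=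
  RingQuot.liftAlgHom ℂ ⟨FreeAlgebra.lift ℂ fun x : ℕ × Fin n × Fin n =>
    yangianOp V mu (x.1 + 1) x.2.1 x.2.2, by
      have hT : ∀ r i j, FreeAlgebra.lift ℂ (fun x : ℕ × Fin n × Fin n =>
          yangianOp V mu (x.1 + 1) x.2.1 x.2.2) (freeT n r i j) = yangianOp V mu r i j := by
        intro r i j
        cases r with
        | zero => rw [freeT, yangianOp_zero]; split_ifs <;> simp
        | succ r => simp [freeT]
      rintro _ _ ⟨r, s, i, j, k, l⟩
      simp only [map_sub, map_mul, hT]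
      exact sub_eq_zero.1 (yangianOp_relation mu r s i j k l)⟩

theorem yangianRep_t (mu : Fin m → ℂ) (r : ℕ) (i j : Fin n) :
    yangianRep V mu (t r i j) = yangianOp V mu r i j := by
  rw [yangianRep, t, RingQuot.liftAlgHom_mkAlgHom_apply]
  cases r with
  | zero => rw [freeT, yangianOp_zero]; split_ifs <;> simp
  | succ r => simp [freeT]

end Main

end CovariantYangian

open CovariantYangian in
/-- Let `V = L(λ)` be an irreducible `gl_{m|n}`-module with highest vector `ζ` of covariant highest
weight `λ`, and `μ` a partition with `0 ≤ λ_i - μ_i ≤ n`. Then `ζ_μ` lies in `L(λ)^+_μ`, the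
Yangian acts on `L(λ)^+_μ` through the shifted Olshanski map, and `ζ_μ` is annihilated by `t_ij(u)`
for `i < j` and is an eigenvector of `t_pp(u)` with eigenvalue `λ_{m+p}(u)`. -/
theorem proposition4p1 (m n : ℕ) (V : Type*) [AddCommGroup V] [Module ℂ V] [Module (UGL m n) V]
    [IsScalarTower ℂ (UGL m n) V] [IsSimpleModule (UGL m n) V]
    (lam : Fin m ⊕ Fin n → ℕ) (hlam : IsCovariantWeight lam)
    (ζ : V) (hζ : IsHighestVector (m := m) (n := n) (fun i => (lam i : ℂ)) ζ)
    (mu : Fin m → ℕ) (hmu : Antitone mu)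
    (hle : ∀ i : Fin m, mu i ≤ lam (Sum.inl i))
    (hge : ∀ i : Fin m, lam (Sum.inl i) ≤ mu i + n) :
    ∃ (hmem : (loweringProduct lam mu : UGL m n) • ζ ∈
          multiplicitySpace n V (fun i => (mu i : ℂ)))
      (ρ : Yangian n →ₐ[ℂ] Module.End ℂ (multiplicitySpace n V (fun i => (mu i : ℂ)))),
      (∀ (r : ℕ) (i j : Fin n) (η : multiplicitySpace n V (fun i => (mu i : ℂ))),
        ((ρ (t r i j) η : multiplicitySpace n V (fun i => (mu i : ℂ))) : V) =
          (shiftedOlshanski m r i j : UGL m n) • (η : V)) ∧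
      (∀ i j : Fin n, i < j → ∀ r : ℕ,
        ρ (t r i j) ⟨(loweringProduct lam mu : UGL m n) • ζ, hmem⟩ = 0) ∧
      (∀ p : Fin n, ∃ f : PowerSeries ℂ,
        (f : LaurentSeries ℂ) = highestWeight lam mu p ∧
        ∀ r : ℕ, ρ (t r p p) ⟨(loweringProduct lam mu : UGL m n) • ζ, hmem⟩ =
          PowerSeries.coeff r f • ⟨(loweringProduct lam mu : UGL m n) • ζ, hmem⟩) := by
  obtain ⟨hη, Λ, hΛ, hser⟩ := loweringProduct_isHighest hlam.1 hmu hζ hle hge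
  have hcoe : ∀ r (i j : Fin n) (v : V), shiftSeq (m : ℂ) (fun r => olsh (actE m n V) r i j) r v =
      shiftSeq (m : ℂ) (fun r => olsh (actE m n V) r i j v) r := fun r i j v =>
    map_shiftSeq (LinearMap.applyₗ v) _ _ _
  refine ⟨⟨hη.raise, hη.weight⟩, yangianRep V _, fun r i j η => ?_, fun i j hij r => ?_,
    fun p => ⟨eigenSeries lam mu 0 p, eigenSeries_zero_coe lam mu p, fun r => ?_⟩⟩
  · rw [yangianRep_t, coe_yangianOp, ← act_shiftedOlshanski, act_apply]
  · refine Subtype.ext ?_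
    rw [yangianRep_t, coe_yangianOp, hcoe]
    simp only [hΛ.raise i j hij]
    -- The shift of the zero sequence is zero, seen as its image under the zero map.
    exact (map_shiftSeq (0 : V →ₗ[ℂ] V) _ (fun _ => 0) r).symm
  · refine Subtype.ext ?_
    rw [yangianRep_t, coe_yangianOp, hcoe]
    simp only [hΛ.eigen]
    rw [← hser]
    -- Shifting the sequence of vectors Λ_r ζ_μ amounts to shifting the scalars, by linearity of c ↦
    -- c ζ_μ.
    exact (map_shiftSeq (LinearMap.toSpanSingleton ℂ V _) _ (Λ p) r).symm
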